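/- Let $A,B$ be finite-dimensional quantum systems, i.e. $\mathbb C^{d_A},\mathbb C^{d_B}$ with fixed bases, let $T_B$ denote the partial transpose on $B$, and let $\langle X,Y\rangle=\operatorname{Tr}(X^\dagger Y)$, $\|X\|_1=\operatorname{Tr}|X|$, and $\|X\|_\infty$ the operator norm. The Rains set is $\mathcal R(A|B)=\{X\succeq 0 : \|X^{T_B}\|_1\le 1\}$, its polar is $\mathcal R^\circ=\{W \text{ Hermitian} : \langle W,X\rangle\le 1\ \forall X\in\mathcal R\}$, and $\Gamma_{\mathcal R^\circ}(W)=\inf\{\lambda\ge 0 : W\in\lambda\mathcal R^\circ\}$. A completely positive trace-preserving (CPTP) map $\Lambda:AB\to A'B'$ is Rains-preserving if $X\in\mathcal R(A|B)$ implies $\Lambda(X)\in\mathcal R(A'|B')$, and it is a PPT operation if $T_{B'}\circ\Lambda\circ T_B$ is completely positive. Let $\Psi_m=|\Psi_m\rangle\langle\Psi_m|$ with $|\Psi_m\rangle=\frac1{\sqrt m}\sum_{i=1}^m|ii\rangle$. For a class $\mathcal O$ of CPTP maps put $F_{\mathcal O}(\rho,m)=\sup_{\Lambda\in\mathcal O}\langle\Lambda(\rho),\Psi_m\rangle$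 (over $\Lambda\in\mathcal O$ with output system $m\times m$), $$E^{(1),\varepsilon}_{d,\mathcal O}(\rho)=\log_2\max\{m\ge 1: F_{\mathcal O}(\rho,m)\ge 1-\varepsilon\},\qquad E^{\infty,0}_{d,\mathcal O}(\rho)=\limsup_{n\to\infty}\frac1n E^{(1),0}_{d,\mathcal O}(\rho^{\otimes n}),$$ where $\rho^{\otimes n}$ is regarded as a state of the bipartite system $A^n|B^n$, and where $\log_2\max\varnothing=-\infty$. Let $\rho$ be a density matrix on $AB$ and let $\Pi_\rho$ be the orthogonal projector onto its support. Then $\Gamma_{\mathcal R^\circ}(\Pi_\rho)>0$ and: 1. the asymptotic zero-error distillable entanglement under the class $\mathrm{RP}$ of Rains-preserving operations is $$E^{\infty,0}_{d,\mathrm{RP}}(\rho)=-\log_2\Gamma_{\mathcal R^\circ}(\Pi_\rho);$$ 2. $\displaystyle \Gamma_{\mathcal R^\circ}(\Pi_\rho)=\min\{\|Q^{T_B}\|_\infty : Q\text{ Hermitian},\ Q\succeq\Pi_\rho\}$, the minimum being attained; 3. $\Gamma_{\mathcal R^\circ}(\Pi_\rho^{\otimes n})=\Gamma_{\mathcal R^\circ}(\Pi_\rho)^n$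 for every $n\in\mathbb N$, the left-hand side being taken with respect to the bipartition $A^n|B^n$; 4. consequently, $E^{\infty,0}_{d,\mathcal O}(\rho)\le-\log_2\Gamma_{\mathcal R^\circ}(\Pi_\rho)$ for every class $\mathcal O$ of PPT operations (a single-letter zero-error Rains bound). -/

import Mathlib

open scoped Matrix ComplexOrder

noncomputable section

namespace ZeroErrorRains

/-- Operators on the bipartite space `ℂ^A ⊗ ℂ^B`, as matrices in the product basis. -/
abbrev BMat (A B : Type*) := Matrix (A × B) (A × B) ℂ

/-- The Hilbert-Schmidt inner product `⟨X, Y⟩ = Tr (X† Y)`; its value is real on Hermitian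
matrices, which are the only ones it is used for. -/
def hsInner {α : Type*} [Fintype α] (X Y : Matrix α α ℂ) : ℝ :=
  ((Xᴴ * Y).trace).re

/-- Density matrices. -/
def IsState {α : Type*} [Fintype α] (ρ : Matrix α α ℂ) : Prop :=
  ρ.PosSemidef ∧ ρ.trace = 1

/-- The partial transpose `T_B` on the second subsystem, as a linear map. -/
def partialTranspose (A B : Type*) : BMat A B →ₗ[ℂ] BMat A B where
  toFun X := Matrix.of fun p q => X (p.1, q.2) (q.1, p.2)
  map_add' _ _ := rfl
  map_smul' _ _ := rfl

open scoped MatrixOrder in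
/-- The trace norm `‖X‖₁ = Tr |X|`, with `|X| = (X† X)^{1/2}`. -/
def traceNorm {α : Type*} [Fintype α] [DecidableEq α] (X : Matrix α α ℂ) : ℝ :=
  ((CFC.abs X).trace).re

/-- The operator norm `‖X‖_∞` of `X` acting on the Euclidean space `ℂ^α`. -/
def opNorm {α : Type*} [Fintype α] [DecidableEq α] (X : Matrix α α ℂ) : ℝ :=
  ‖Matrix.toEuclideanCLM (n := α) (𝕜 := ℂ) X‖

/-- The orthogonal projector onto the support (the range) of a Hermitian matrix `ρ`. -/
def supportProj {α : Type*} [Fintype α] [DecidableEq α] (ρ : Matrix α α ℂ) : Matrix α α ℂ :=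
  (Matrix.toEuclideanCLM (n := α) (𝕜 := ℂ)).symm
    (LinearMap.range (Matrix.toEuclideanCLM (n := α) (𝕜 := ℂ) ρ).toLinearMap).starProjection

/-- The tensor power `X^{⊗ n}`, regarded as an operator of the bipartite system with parts
`A^n` and `B^n`. -/
def tensorPow {A B : Type*} (X : BMat A B) (n : ℕ) : BMat (Fin n → A) (Fin n → B) :=
  Matrix.of fun p q => ∏ i, X (p.1 i, p.2 i) (q.1 i, q.2 i)

/-- The Rains set `{X ⪰ 0 | ‖X^{T_B}‖₁ ≤ 1}`. -/
def rainsSet (A B : Type*) [Fintype A] [Fintype B] [DecidableEq A] [DecidableEq B] :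
    Set (BMat A B) :=
  {X | X.PosSemidef ∧ traceNorm (partialTranspose A B X) ≤ 1}

/-- The polar `S° = {X | ⟨X, Y⟩ ≤ 1 for all Y ∈ S}` in the real space of Hermitian matrices. -/
def polar {α : Type*} [Fintype α] (S : Set (Matrix α α ℂ)) : Set (Matrix α α ℂ) :=
  {X | X.IsHermitian ∧ ∀ Y ∈ S, hsInner X Y ≤ 1}

/-- The gauge function of the polar of the Rains set. -/
def gammaRains {A B : Type*} [Fintype A] [Fintype B] [DecidableEq A] [DecidableEq B]
    (W : BMat A B) : ℝ :=
  gauge (polar (rainsSet A B)) W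

/-- The map `id_κ ⊗ Λ`. -/
def ampliation (κ : Type*) {α β : Type*} (Λ : Matrix α α ℂ →ₗ[ℂ] Matrix β β ℂ)
    (X : Matrix (κ × α) (κ × α) ℂ) : Matrix (κ × β) (κ × β) ℂ :=
  Matrix.of fun p q => Λ (Matrix.of fun a a' => X (p.1, a) (q.1, a')) p.2 q.2

/-- Complete positivity: `id_k ⊗ Λ` preserves positive semidefiniteness for every `k`. -/
def IsCP {α β : Type*} (Λ : Matrix α α ℂ →ₗ[ℂ] Matrix β β ℂ) : Prop :=
  ∀ (k : ℕ) (X : Matrix (Fin k × α) (Fin k × α) ℂ),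
    X.PosSemidef → (ampliation (Fin k) Λ X).PosSemidef

/-- Completely positive trace-preserving maps. -/
def IsCPTP {α β : Type*} [Fintype α] [Fintype β]
    (Λ : Matrix α α ℂ →ₗ[ℂ] Matrix β β ℂ) : Prop :=
  IsCP Λ ∧ ∀ X, (Λ X).trace = X.trace

/-- Rains-preserving operations `AB → A'B'`: channels mapping the Rains set to the Rains set. -/
def rainsPreserving (A B A' B' : Type*) [Fintype A] [Fintype B] [Fintype A'] [Fintype B']
    [DecidableEq A] [DecidableEq B] [DecidableEq A'] [DecidableEq B'] :
    Set (BMat A B →ₗ[ℂ] BMat A' B') :=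
  {Λ | IsCPTP Λ ∧ ∀ X ∈ rainsSet A B, Λ X ∈ rainsSet A' B'}

/-- PPT operations `AB → A'B'`: channels `Λ` such that `T_{B'} ∘ Λ ∘ T_B` is completely
positive. -/
def pptOperations (A B A' B' : Type*) [Fintype A] [Fintype B] [Fintype A'] [Fintype B'] :
    Set (BMat A B →ₗ[ℂ] BMat A' B') :=
  {Λ | IsCPTP Λ ∧ IsCP (partialTranspose A' B' ∘ₗ Λ ∘ₗ partialTranspose A B)}

/-- The vector `∑ i, |ii⟩ / √m`. -/
def maxEntVec (m : ℕ) : Fin m × Fin m → ℂ :=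
  fun p => if p.1 = p.2 then (((1 / Real.sqrt m : ℝ)) : ℂ) else 0

/-- The maximally entangled state `Ψ_m`. -/
def maxEnt (m : ℕ) : BMat (Fin m) (Fin m) :=
  Matrix.vecMulVec (maxEntVec m) (star (maxEntVec m))

/-- The fidelity of distillation `sup_{Λ ∈ 𝒪} ⟨Λ(ρ), Ψ_m⟩`. -/
def fidelity {A B : Type*} {m : ℕ} (𝒪 : Set (BMat A B →ₗ[ℂ] BMat (Fin m) (Fin m)))
    (ρ : BMat A B) : ℝ :=
  sSup ((fun Λ => hsInner (Λ ρ) (maxEnt m)) '' 𝒪)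

/-- The one-shot `ε`-error distillable entanglement
`log max {m ≥ 1 | F(ρ, m) ≥ 1 - ε}` (base 2), written as the supremum of `log m` in the extended
reals. The set `𝒪 m` consists of the allowed operations with output system `m × m`. -/
def oneShotDistillable {A B : Type*}
    (𝒪 : ∀ m : ℕ, Set (BMat A B →ₗ[ℂ] BMat (Fin m) (Fin m))) (ε : ℝ) (ρ : BMat A B) : EReal :=
  ⨆ m ∈ {m : ℕ | 1 ≤ m ∧ 1 - ε ≤ fidelity (𝒪 m) ρ}, ((Real.logb 2 m : ℝ) : EReal)

/-- The asymptotic zero-error distillable entanglement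
`limsup_n (1/n) E^{(1),0}(ρ^{⊗ n})`. The set `𝒪 n m` consists of the allowed operations with
input system `A^n B^n` and output system `m × m`. -/
def asymptoticZeroError {A B : Type*}
    (𝒪 : ∀ n m : ℕ, Set (BMat (Fin n → A) (Fin n → B) →ₗ[ℂ] BMat (Fin m) (Fin m)))
    (ρ : BMat A B) : EReal :=
  Filter.limsup
    (fun n : ℕ => ((1 / (n : ℝ) : ℝ) : EReal) * oneShotDistillable (𝒪 n) 0 (tensorPow ρ n))
    Filter.atTop

end ZeroErrorRains

end

/-!
Hahn-Banach separation of the compact convex set `{Q | ‖Q^{T_B}‖ ≤ c}` from the cone `W + {P ⪰ 0}`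
shows that `⟨W, Y⟩ ≤ c` on the Rains set only if some `Q ⪰ W` has `‖Q^{T_B}‖ ≤ c`, so the gauge of
the polar is the attained minimum of `‖Q^{T_B}‖` over `Q ⪰ W`. Tensor powers of an optimal `Q` bound
the gauge of `W^{⊗n}` from above, tensor powers of elements of the Rains set bound it from below,
and both bounds are the `n`-th power of the gauge of `W`.

A Rains-preserving `Λ` pulls the projector `Ψ_m` back to an effect `Λ†(Ψ_m)` of weight at most
`1 / m` on the Rains set, and zero error forces this effect to dominate `Π_ρ`. Conversely, if `Π_ρ`
itself has weight at most `1 / m` on the Rains set, then the operation that measures `Π_ρ` and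
prepares `Ψ_m` or the isotropic state orthogonal to it is Rains-preserving. Hence `m` is achievable
without error iff the gauge of `Π_ρ` is at most `1 / m`, and rounding `m` to an integer costs at
most one bit, which disappears in the limit. PPT operations are Rains-preserving because
`T_{B'} ∘ Λ ∘ T_B` is positive and trace-preserving, hence contracts the trace norm.
-/

noncomputable section

namespace ZeroErrorRains

open Filter Topology
open scoped Kronecker MatrixOrder Matrix.Norms.L2Operator

section HilbertSchmidt

variable {α : Type*}

theorem isHermitian_real_smul {X : Matrix α α ℂ} (hX : X.IsHermitian) (c : ℝ) :
    (c • X).IsHermitian :=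
  IsSelfAdjoint.smul (IsSelfAdjoint.all c) hX

variable [Fintype α]

theorem hsInner_add_left (X Y Z : Matrix α α ℂ) :
    hsInner (X + Y) Z = hsInner X Z + hsInner Y Z := by
  simp [hsInner, add_mul]

theorem hsInner_sub_left (X Y Z : Matrix α α ℂ) :
    hsInner (X - Y) Z = hsInner X Z - hsInner Y Z := by
  simp [hsInner, sub_mul]

theorem hsInner_smul_left (c : ℝ) (X Y : Matrix α α ℂ) :
    hsInner (c • X) Y = c * hsInner X Y := by
  simp [hsInner]

theorem hsInner_add_right (X Y Z : Matrix α α ℂ) :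
    hsInner X (Y + Z) = hsInner X Y + hsInner X Z := by
  simp [hsInner, mul_add]

theorem hsInner_sub_right (X Y Z : Matrix α α ℂ) :
    hsInner X (Y - Z) = hsInner X Y - hsInner X Z := by
  simp [hsInner, mul_sub]

theorem hsInner_smul_right (c : ℝ) (X Y : Matrix α α ℂ) :
    hsInner X (c • Y) = c * hsInner X Y := by
  simp [hsInner]

theorem hsInner_neg_left (X Y : Matrix α α ℂ) : hsInner (-X) Y = -hsInner X Y := by
  simp [hsInner]

theorem hsInner_comm (X Y : Matrix α α ℂ) : hsInner X Y = hsInner Y X := by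
  have h : Xᴴ * Y = (Yᴴ * X)ᴴ := by simp
  rw [hsInner, h, Matrix.trace_conjTranspose]
  simp [hsInner]

theorem hsInner_one_left [DecidableEq α] (X : Matrix α α ℂ) : hsInner 1 X = X.trace.re := by
  simp [hsInner]

theorem coe_hsInner {X Y : Matrix α α ℂ} (hX : X.IsHermitian) (hY : Y.IsHermitian) :
    (hsInner X Y : ℂ) = (X * Y).trace := by
  refine Complex.ext (by simp [hsInner, hX.eq]) ?_
  have h : star (X * Y).trace = (X * Y).trace := by
    rw [← Matrix.trace_conjTranspose, Matrix.conjTranspose_mul, hX.eq, hY.eq,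
      Matrix.trace_mul_comm]
  simpa using (Complex.conj_eq_iff_im.mp h).symm

theorem continuous_hsInner_left (Y : Matrix α α ℂ) : Continuous (hsInner · Y) := by
  unfold hsInner
  fun_prop

theorem exists_eq_conjTranspose_mul_self {X : Matrix α α ℂ} (hX : X.PosSemidef) :
    ∃ C : Matrix α α ℂ, X = Cᴴ * C := by
  classical exact CStarAlgebra.nonneg_iff_eq_star_mul_self.mp hX.nonneg

theorem trace_conjTranspose_mul_self_mul (C Y : Matrix α α ℂ) :
    (Cᴴ * C * Y).trace = (C * Y * Cᴴ).trace := by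
  rw [Matrix.mul_assoc, Matrix.trace_mul_comm]

theorem hsInner_nonneg {X Y : Matrix α α ℂ} (hX : X.PosSemidef) (hY : Y.PosSemidef) :
    0 ≤ hsInner X Y := by
  rw [hsInner, hX.isHermitian.eq]
  obtain ⟨C, rfl⟩ := exists_eq_conjTranspose_mul_self hX
  rw [trace_conjTranspose_mul_self_mul]
  exact (Complex.nonneg_iff.mp (hY.mul_mul_conjTranspose_same C).trace_nonneg).1

theorem hsInner_mono_left {X X' Y : Matrix α α ℂ} (h : X ≤ X') (hY : Y.PosSemidef) :
    hsInner X Y ≤ hsInner X' Y := by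
  simpa [hsInner_sub_left] using hsInner_nonneg (Matrix.le_iff.mp h) hY

theorem mul_eq_zero_of_hsInner_eq_zero {X Y : Matrix α α ℂ} (hX : X.PosSemidef)
    (hY : Y.PosSemidef) (h : hsInner X Y = 0) : X * Y = 0 := by
  have htrace : (X * Y).trace = 0 := by
    rw [← coe_hsInner hX.isHermitian hY.isHermitian, h, Complex.ofReal_zero]
  obtain ⟨C, rfl⟩ := exists_eq_conjTranspose_mul_self hX
  obtain ⟨D, rfl⟩ := exists_eq_conjTranspose_mul_self hY
  have hDC : D * Cᴴ = 0 := by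
    rw [← Matrix.trace_conjTranspose_mul_self_eq_zero_iff, ← htrace,
      trace_conjTranspose_mul_self_mul]
    simp only [Matrix.conjTranspose_mul, Matrix.conjTranspose_conjTranspose, Matrix.mul_assoc]
  have hCD : C * Dᴴ = 0 := by simpa using congrArg Matrix.conjTranspose hDC
  calc Cᴴ * C * (Dᴴ * D) = Cᴴ * (C * Dᴴ) * D := by simp only [Matrix.mul_assoc]
    _ = 0 := by rw [hCD, Matrix.mul_zero, Matrix.zero_mul]

theorem posSemidef_of_hsInner_nonneg {X : Matrix α α ℂ} (hX : X.IsHermitian)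
    (h : ∀ Y : Matrix α α ℂ, Y.PosSemidef → 0 ≤ hsInner X Y) : X.PosSemidef := by
  refine Matrix.PosSemidef.of_dotProduct_mulVec_nonneg hX fun v => ?_
  have hv := Matrix.posSemidef_vecMulVec_self_star v
  have hXv : star v ⬝ᵥ X *ᵥ v = (X * Matrix.vecMulVec v (star v)).trace := by
    rw [Matrix.mul_vecMulVec, Matrix.trace_vecMulVec, dotProduct_comm]
  rw [hXv, ← coe_hsInner hX hv.isHermitian, Complex.zero_le_real]
  exact h _ hv

/-- The inner product `⟨X, Y⟩` on the real space of Hermitian matrices. -/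
def hsForm (α : Type*) [Fintype α] :
    LinearMap.BilinForm ℝ (selfAdjoint.submodule ℝ (Matrix α α ℂ)) :=
  LinearMap.mk₂ ℝ (fun X Y => hsInner X.1 Y.1) (fun _ _ _ => hsInner_add_left _ _ _)
    (fun _ _ _ => hsInner_smul_left _ _ _) (fun _ _ _ => hsInner_add_right _ _ _)
    (fun _ _ _ => hsInner_smul_right _ _ _)

theorem nondegenerate_hsForm : (hsForm α).Nondegenerate := by
  have separating (X : selfAdjoint.submodule ℝ (Matrix α α ℂ)) (h : hsInner X.1 X.1 = 0) :
      X = 0 := by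
    have hX : X.1.IsHermitian := X.2
    have htrace := coe_hsInner hX hX
    rw [h, Complex.ofReal_zero] at htrace
    refine Subtype.ext ((Matrix.trace_conjTranspose_mul_self_eq_zero_iff (A := X.1)).mp ?_)
    rw [hX.eq, ← htrace]
  exact ⟨fun X h => separating X (h X), fun X h => separating X (h X)⟩

theorem exists_hsInner_eq (f : selfAdjoint.submodule ℝ (Matrix α α ℂ) →ₗ[ℝ] ℝ) :
    ∃ W : Matrix α α ℂ, W.IsHermitian ∧
      ∀ X (hX : X.IsHermitian), f ⟨X, hX⟩ = hsInner W X := by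
  let W := ((hsForm α).toDual nondegenerate_hsForm).symm f
  exact ⟨W.1, W.2, fun X hX =>
    (LinearMap.BilinForm.apply_toDual_symm_apply (B := hsForm α)
      (hB := nondegenerate_hsForm) f ⟨X, hX⟩).symm⟩

end HilbertSchmidt

section Norms

variable {α : Type*} [Fintype α] [DecidableEq α]

theorem le_norm_smul_one {X : Matrix α α ℂ} (hX : X.IsHermitian) : X ≤ ‖X‖ • 1 := by
  simpa [Algebra.algebraMap_eq_smul_one] using
    IsSelfAdjoint.le_algebraMap_norm_self (show IsSelfAdjoint X from hX)

theorem le_one_of_norm_le_one {X : Matrix α α ℂ} (hX : X.IsHermitian) (h : ‖X‖ ≤ 1) : X ≤ 1 := by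
  refine (le_norm_smul_one hX).trans ?_
  simpa using smul_le_smul_of_nonneg_right h (zero_le_one (α := Matrix α α ℂ))

theorem norm_one_le : ‖(1 : Matrix α α ℂ)‖ ≤ 1 := by
  rw [Matrix.cstar_norm_def, map_one]
  exact ContinuousLinearMap.norm_id_le

theorem hsInner_le_norm_mul_trace {U P : Matrix α α ℂ} (hU : U.IsHermitian)
    (hP : P.PosSemidef) : hsInner U P ≤ ‖U‖ * P.trace.re := by
  simpa [hsInner_smul_left, hsInner_one_left] using hsInner_mono_left (le_norm_smul_one hU) hP

theorem traceNorm_eq_trace_posPart_add {Y : Matrix α α ℂ} (hY : Y.IsHermitian) :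
    traceNorm Y = (Y⁺).trace.re + (Y⁻).trace.re := by
  rw [traceNorm, ← CFC.posPart_add_negPart Y hY, Matrix.trace_add, Complex.add_re]

theorem hsInner_le_norm_mul_traceNorm {U Y : Matrix α α ℂ} (hU : U.IsHermitian)
    (hY : Y.IsHermitian) : hsInner U Y ≤ ‖U‖ * traceNorm Y := by
  calc hsInner U Y = hsInner U Y⁺ + hsInner (-U) Y⁻ := by
        rw [hsInner_neg_left, ← sub_eq_add_neg, ← hsInner_sub_right,
          CFC.posPart_sub_negPart Y hY]
    _ ≤ ‖U‖ * (Y⁺).trace.re + ‖-U‖ * (Y⁻).trace.re :=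
        add_le_add
          (hsInner_le_norm_mul_trace hU (Matrix.nonneg_iff_posSemidef.mp (CFC.posPart_nonneg Y)))
          (hsInner_le_norm_mul_trace hU.neg
            (Matrix.nonneg_iff_posSemidef.mp (CFC.negPart_nonneg Y)))
    _ = ‖U‖ * traceNorm Y := by rw [norm_neg, traceNorm_eq_trace_posPart_add hY, mul_add]

theorem exists_hsInner_eq_traceNorm {Y : Matrix α α ℂ} (hY : Y.IsHermitian) :
    ∃ U : Matrix α α ℂ, U.IsHermitian ∧ ‖U‖ ≤ 1 ∧ hsInner U Y = traceNorm Y := by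
  have hcont (f : ℝ → ℝ) : ContinuousOn f (spectrum ℝ Y) :=
    Matrix.finite_real_spectrum.continuousOn f
  let U : Matrix α α ℂ := cfc (fun x : ℝ => (SignType.sign x : ℝ)) Y
  have hU : U.IsHermitian := cfc_predicate (p := IsSelfAdjoint) _ Y
  refine ⟨U, hU, norm_cfc_le zero_le_one fun x _ => ?_, ?_⟩
  · rcases lt_trichotomy x 0 with hx | rfl | hx <;> simp [*]
  · have hUY : U * Y = CFC.abs Y := calc
      U * Y = U * cfc (fun x : ℝ => x) Y :=
        congrArg (U * ·) (cfc_id' ℝ Y (show IsSelfAdjoint Y from hY)).symm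
      _ = cfc (fun x : ℝ => (SignType.sign x : ℝ) * x) Y := (cfc_mul _ _ Y (hcont _) (hcont _)).symm
      _ = CFC.abs Y := by
        simp only [sign_mul_self]
        exact (CFC.abs_eq_cfc_norm Y hY).symm
    rw [hsInner, hU.eq, hUY, traceNorm]

theorem traceNorm_nonneg (X : Matrix α α ℂ) : 0 ≤ traceNorm X :=
  (Complex.nonneg_iff.mp (Matrix.nonneg_iff_posSemidef.mp (CFC.abs_nonneg X)).trace_nonneg).1

theorem traceNorm_add_le {X Y : Matrix α α ℂ} (hX : X.IsHermitian) (hY : Y.IsHermitian) :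
    traceNorm (X + Y) ≤ traceNorm X + traceNorm Y := by
  obtain ⟨U, hU, hU1, hUXY⟩ := exists_hsInner_eq_traceNorm (hX.add hY)
  calc traceNorm (X + Y) = hsInner U X + hsInner U Y := by rw [← hUXY, hsInner_add_right]
    _ ≤ ‖U‖ * traceNorm X + ‖U‖ * traceNorm Y :=
        add_le_add (hsInner_le_norm_mul_traceNorm hU hX) (hsInner_le_norm_mul_traceNorm hU hY)
    _ ≤ traceNorm X + traceNorm Y :=
        add_le_add (mul_le_of_le_one_left (traceNorm_nonneg X) hU1)
          (mul_le_of_le_one_left (traceNorm_nonneg Y) hU1)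

theorem traceNorm_smul (c : ℝ) (X : Matrix α α ℂ) : traceNorm (c • X) = |c| * traceNorm X := by
  simp [traceNorm, CFC.abs_smul]

theorem traceNorm_of_posSemidef {X : Matrix α α ℂ} (hX : X.PosSemidef) :
    traceNorm X = X.trace.re := by
  rw [traceNorm, CFC.abs_of_nonneg X hX.nonneg]

theorem traceNorm_eq_zero_iff {X : Matrix α α ℂ} : traceNorm X = 0 ↔ X = 0 := by
  have habs := Matrix.nonneg_iff_posSemidef.mp (CFC.abs_nonneg X)
  rw [← CFC.abs_eq_zero_iff (a := X), ← habs.trace_eq_zero_iff, Complex.ext_iff, traceNorm]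
  simp [← (Complex.nonneg_iff.mp habs.trace_nonneg).2]

end Norms

section PartialTranspose

variable {A B : Type*}

theorem partialTranspose_apply (X : BMat A B) (p q : A × B) :
    partialTranspose A B X p q = X (p.1, q.2) (q.1, p.2) := rfl

@[simp]
theorem partialTranspose_partialTranspose (X : BMat A B) :
    partialTranspose A B (partialTranspose A B X) = X := rfl

theorem partialTranspose_real_smul (c : ℝ) (X : BMat A B) :
    partialTranspose A B (c • X) = c • partialTranspose A B X := rfl

theorem isHermitian_partialTranspose {X : BMat A B} (hX : X.IsHermitian) :
    (partialTranspose A B X).IsHermitian := by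
  ext p q
  exact congrFun (congrFun hX (p.1, q.2)) (q.1, p.2)

theorem partialTranspose_one [DecidableEq A] [DecidableEq B] :
    partialTranspose A B 1 = 1 := by
  ext p q
  simp only [partialTranspose_apply, Matrix.one_apply, Prod.ext_iff, eq_comm]

variable [Fintype A] [Fintype B]

theorem trace_partialTranspose (X : BMat A B) : (partialTranspose A B X).trace = X.trace := rfl

theorem hsInner_partialTranspose (X Y : BMat A B) :
    hsInner (partialTranspose A B X) (partialTranspose A B Y) = hsInner X Y := by
  simp only [hsInner, Matrix.trace, Matrix.diag, Matrix.mul_apply, Matrix.conjTranspose_apply,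
    partialTranspose_apply, Fintype.sum_prod_type]
  congr 1
  rw [Finset.sum_congr rfl fun a _ => Finset.sum_comm]
  conv_rhs => rw [Finset.sum_congr rfl fun a _ => Finset.sum_comm]
  refine Finset.sum_congr rfl fun a _ => Finset.sum_congr rfl fun a' _ => ?_
  exact Finset.sum_comm

end PartialTranspose

section Duality

theorem exists_posSemidef_hsInner_lt {α : Type*} [Fintype α]
    {s : Set (Matrix α α ℂ)} (hconv : Convex ℝ s) (hcompact : IsCompact s)
    (hherm : ∀ Q ∈ s, Q.IsHermitian) {W : Matrix α α ℂ} (hW : W.IsHermitian)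
    (h : ∀ Q ∈ s, ¬ W ≤ Q) :
    ∃ X : Matrix α α ℂ, X.PosSemidef ∧ ∀ Q ∈ s, hsInner X Q < hsInner X W := by
  classical
  have hdisj : Disjoint s (Set.Ici W) := Set.disjoint_left.mpr h
  obtain ⟨f, u, v, hfs, huv, hft⟩ :=
    geometric_hahn_banach_compact_closed hconv hcompact (convex_Ici W) isClosed_Ici hdisj
  obtain ⟨X, hX, hfX⟩ := exists_hsInner_eq
    (f.toLinearMap ∘ₗ (selfAdjoint.submodule ℝ (Matrix α α ℂ)).subtype)
  replace hfX (Y : Matrix α α ℂ) (hY : Y.IsHermitian) : f Y = hsInner X Y := hfX Y hY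
  have hvW : v < f W := hft W Set.self_mem_Ici
  refine ⟨X, posSemidef_of_hsInner_nonneg hX fun P hP => ?_, fun Q hQ => ?_⟩
  · rw [← hfX P hP.isHermitian]
    by_contra! hneg
    obtain ⟨t, ht, hval⟩ : ∃ t : ℝ, 0 ≤ t ∧ f W + t * f P = v := by
      refine ⟨(f W - v) / -f P, div_nonneg (sub_nonneg.mpr hvW.le) (neg_nonneg.mpr hneg.le), ?_⟩
      rw [div_neg, neg_mul, div_mul_cancel₀ _ hneg.ne]
      ring
    have hlt : v < f (W + t • P) := hft _ (le_add_of_nonneg_right (hP.smul ht).nonneg)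
    rw [map_add, map_smul, smul_eq_mul] at hlt
    exact hlt.ne' hval
  · rw [← hfX Q (hherm Q hQ), ← hfX W hW]
    exact (hfs Q hQ).trans (huv.trans hvW)

theorem isCompact_isHermitian_norm_le (α : Type*) [Fintype α] [DecidableEq α] (c : ℝ) :
    IsCompact {X : Matrix α α ℂ | X.IsHermitian ∧ ‖X‖ ≤ c} := by
  have := FiniteDimensional.proper ℂ (Matrix α α ℂ)
  have hclosed : IsClosed {X : Matrix α α ℂ | X.IsHermitian} :=
    isClosed_eq (by fun_prop) continuous_id
  simpa [Set.inter_def] using (isCompact_closedBall (0 : Matrix α α ℂ) c).inter_left hclosed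

theorem convex_isHermitian_norm_le (α : Type*) [Fintype α] [DecidableEq α] (c : ℝ) :
    Convex ℝ {X : Matrix α α ℂ | X.IsHermitian ∧ ‖X‖ ≤ c} := by
  have hconv : Convex ℝ {X : Matrix α α ℂ | X.IsHermitian} :=
    (selfAdjoint.submodule ℝ (Matrix α α ℂ)).convex
  simpa [Set.inter_def] using hconv.inter (convex_closedBall (0 : Matrix α α ℂ) c)

variable {A B : Type*} [Fintype A] [Fintype B] [DecidableEq A] [DecidableEq B]

theorem zero_mem_rainsSet : (0 : BMat A B) ∈ rainsSet A B := by
  refine ⟨Matrix.PosSemidef.zero, ?_⟩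
  rw [map_zero, traceNorm_eq_zero_iff.mpr rfl]
  exact zero_le_one

theorem smul_mem_rainsSet {X : BMat A B} (hX : X.PosSemidef) {c : ℝ} (hc : 0 ≤ c)
    (h : c * traceNorm (partialTranspose A B X) ≤ 1) : c • X ∈ rainsSet A B := by
  refine ⟨hX.smul hc, ?_⟩
  rwa [partialTranspose_real_smul, traceNorm_smul, abs_of_nonneg hc]

theorem hsInner_le_mul_traceNorm_partialTranspose {W : BMat A B} {c : ℝ}
    (h : ∀ Y ∈ rainsSet A B, hsInner W Y ≤ c) {X : BMat A B} (hX : X.PosSemidef) :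
    hsInner W X ≤ c * traceNorm (partialTranspose A B X) := by
  rcases (traceNorm_nonneg (partialTranspose A B X)).eq_or_lt with h0 | hpos
  · have hX0 : X = 0 := by
      rw [← partialTranspose_partialTranspose X, traceNorm_eq_zero_iff.mp h0.symm, map_zero]
    rw [← h0, hX0]
    simp [hsInner]
  · have hmem := smul_mem_rainsSet hX (inv_nonneg.mpr hpos.le) (inv_mul_cancel₀ hpos.ne').le
    rw [← div_le_iff₀ hpos, div_eq_inv_mul, ← hsInner_smul_right]
    exact h _ hmem

theorem hsInner_le_norm_partialTranspose {Q W Y : BMat A B} (hQ : Q.IsHermitian) (hWQ : W ≤ Q)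
    (hY : Y ∈ rainsSet A B) : hsInner W Y ≤ ‖partialTranspose A B Q‖ :=
  calc hsInner W Y ≤ hsInner Q Y := hsInner_mono_left hWQ hY.1
    _ = hsInner (partialTranspose A B Q) (partialTranspose A B Y) :=
        (hsInner_partialTranspose Q Y).symm
    _ ≤ ‖partialTranspose A B Q‖ * traceNorm (partialTranspose A B Y) :=
        hsInner_le_norm_mul_traceNorm (isHermitian_partialTranspose hQ)
          (isHermitian_partialTranspose hY.1.isHermitian)
    _ ≤ ‖partialTranspose A B Q‖ := mul_le_of_le_one_right (norm_nonneg _) hY.2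

theorem exists_norm_partialTranspose_le {W : BMat A B} (hW : W.IsHermitian) {c : ℝ}
    (h : ∀ Y ∈ rainsSet A B, hsInner W Y ≤ c) :
    ∃ Q : BMat A B, Q.IsHermitian ∧ W ≤ Q ∧ ‖partialTranspose A B Q‖ ≤ c := by
  have hc : 0 ≤ c := by simpa [hsInner] using h 0 zero_mem_rainsSet
  by_contra! hcon
  obtain ⟨X, hX, hlt⟩ := exists_posSemidef_hsInner_lt
    ((convex_isHermitian_norm_le (A × B) c).linear_image
      ((partialTranspose A B).restrictScalars ℝ))
    ((isCompact_isHermitian_norm_le (A × B) c).image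
      (LinearMap.continuous_of_finiteDimensional (partialTranspose A B)))
    (by rintro _ ⟨Y, hY, rfl⟩; exact isHermitian_partialTranspose hY.1) hW
    (by
      rintro _ ⟨Y, hY, rfl⟩ hWY
      exact (hcon _ (isHermitian_partialTranspose hY.1) hWY).not_ge hY.2)
  obtain ⟨U, hU, hU1, hUX⟩ :=
    exists_hsInner_eq_traceNorm (isHermitian_partialTranspose hX.isHermitian)
  have hcU : ‖c • U‖ ≤ c := by
    rw [norm_smul, Real.norm_of_nonneg hc]
    exact mul_le_of_le_one_right hc hU1
  refine (hsInner_le_mul_traceNorm_partialTranspose h hX).not_gt ?_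
  calc c * traceNorm (partialTranspose A B X) = hsInner (c • U) (partialTranspose A B X) := by
        rw [hsInner_smul_left, hUX]
    _ = hsInner X (partialTranspose A B (c • U)) := by
        rw [hsInner_comm, ← hsInner_partialTranspose, partialTranspose_partialTranspose]
    _ < hsInner X W := hlt _ ⟨c • U, ⟨isHermitian_real_smul hU c, hcU⟩, rfl⟩
    _ = hsInner W X := hsInner_comm X W

open scoped Pointwise in
theorem mem_smul_polar_iff {W : BMat A B} (hW : W.IsHermitian) {r : ℝ} (hr : 0 < r) :
    W ∈ r • polar (rainsSet A B) ↔ ∀ Y ∈ rainsSet A B, hsInner W Y ≤ r := by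
  rw [Set.mem_smul_set_iff_inv_smul_mem₀ hr.ne']
  simp only [polar, Set.mem_ofPred_eq, isHermitian_real_smul hW, true_and, hsInner_smul_left,
    inv_mul_le_iff₀ hr, mul_one]

theorem gammaRains_nonneg (W : BMat A B) : 0 ≤ gammaRains W := gauge_nonneg _

open scoped Pointwise in
theorem hsInner_le_gammaRains {W Y : BMat A B} (hW : W.IsHermitian) (hY : Y ∈ rainsSet A B) :
    hsInner W Y ≤ gammaRains W := by
  have hpos : 0 < ‖partialTranspose A B W‖ + 1 := by positivity
  refine le_csInf ⟨_, hpos, (mem_smul_polar_iff hW hpos).mpr fun Y hY => ?_⟩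
    fun r ⟨hr, hWr⟩ => (mem_smul_polar_iff hW hr).mp hWr Y hY
  exact (hsInner_le_norm_partialTranspose hW le_rfl hY).trans (le_add_of_nonneg_right zero_le_one)

theorem gammaRains_le_iff {W : BMat A B} (hW : W.IsHermitian) {c : ℝ} (hc : 0 ≤ c) :
    gammaRains W ≤ c ↔ ∀ Y ∈ rainsSet A B, hsInner W Y ≤ c := by
  refine ⟨fun h Y hY => (hsInner_le_gammaRains hW hY).trans h, fun h => ?_⟩
  refine le_of_forall_gt_imp_ge_of_dense fun a ha => ?_
  have ha0 : 0 < a := hc.trans_lt ha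
  exact gauge_le_of_mem ha0.le
    ((mem_smul_polar_iff hW ha0).mpr fun Y hY => (h Y hY).trans ha.le)

theorem gammaRains_le_norm_partialTranspose {W Q : BMat A B} (hW : W.IsHermitian)
    (hQ : Q.IsHermitian) (hWQ : W ≤ Q) : gammaRains W ≤ ‖partialTranspose A B Q‖ :=
  (gammaRains_le_iff hW (norm_nonneg _)).mpr fun _ hY =>
    hsInner_le_norm_partialTranspose hQ hWQ hY

theorem exists_norm_partialTranspose_eq_gammaRains {W : BMat A B} (hW : W.IsHermitian) :
    ∃ Q : BMat A B, Q.IsHermitian ∧ W ≤ Q ∧ ‖partialTranspose A B Q‖ = gammaRains W := by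
  obtain ⟨Q, hQ, hWQ, hle⟩ :=
    exists_norm_partialTranspose_le hW fun Y hY => hsInner_le_gammaRains hW hY
  exact ⟨Q, hQ, hWQ, hle.antisymm (gammaRains_le_norm_partialTranspose hW hQ hWQ)⟩

theorem isLeast_gammaRains {W : BMat A B} (hW : W.IsHermitian) :
    IsLeast {r : ℝ | ∃ Q : BMat A B, Q.IsHermitian ∧ (Q - W).PosSemidef ∧
      r = opNorm (partialTranspose A B Q)} (gammaRains W) := by
  constructor
  · obtain ⟨Q, hQ, hWQ, hnorm⟩ := exists_norm_partialTranspose_eq_gammaRains hW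
    exact ⟨Q, hQ, hWQ, hnorm.symm⟩
  · rintro _ ⟨Q, hQ, hWQ, rfl⟩
    exact gammaRains_le_norm_partialTranspose hW hQ hWQ

theorem gammaRains_pos {W : BMat A B} (hW : W.PosSemidef) (hW0 : W ≠ 0) : 0 < gammaRains W := by
  refine (gammaRains_nonneg W).lt_of_ne fun h0 => hW0 ?_
  obtain ⟨Q, -, hWQ, hnorm⟩ := exists_norm_partialTranspose_eq_gammaRains hW.isHermitian
  have hQ0 : Q = 0 := by
    rw [← partialTranspose_partialTranspose Q, norm_eq_zero.mp (hnorm.trans h0.symm), map_zero]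
  exact le_antisymm (hQ0 ▸ hWQ) hW.nonneg

theorem gammaRains_le_one {W : BMat A B} (hW : W.IsHermitian) (hW1 : W ≤ 1) :
    gammaRains W ≤ 1 := by
  refine (gammaRains_le_norm_partialTranspose hW Matrix.isHermitian_one hW1).trans ?_
  rw [partialTranspose_one]
  exact norm_one_le

end Duality

section TensorPowers

variable {A B : Type*} {n : ℕ}

/-- The tensor product of a family of bipartite operators, as an operator of the bipartite system
with parts `A^n` and `B^n`. It serves to expand tensor powers of sums. -/
def tensorProd (X : Fin n → BMat A B) : BMat (Fin n → A) (Fin n → B) :=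
  Matrix.of fun p q => ∏ i, X i (p.1 i, p.2 i) (q.1 i, q.2 i)

theorem conjTranspose_tensorProd (X : Fin n → BMat A B) :
    (tensorProd X)ᴴ = tensorProd fun i => (X i)ᴴ := by
  ext p q
  simp [tensorProd]

theorem conjTranspose_tensorPow (X : BMat A B) : (tensorPow X n)ᴴ = tensorPow Xᴴ n :=
  conjTranspose_tensorProd _

theorem isHermitian_tensorPow {X : BMat A B} (hX : X.IsHermitian) :
    (tensorPow X n).IsHermitian := by
  rw [Matrix.IsHermitian, conjTranspose_tensorPow, hX.eq]

theorem partialTranspose_tensorPow (X : BMat A B) :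
    partialTranspose _ _ (tensorPow X n) = tensorPow (partialTranspose A B X) n := rfl

theorem tensorPow_smul (c : ℝ) (X : BMat A B) : tensorPow (c • X) n = c ^ n • tensorPow X n := by
  ext p q
  simp [tensorPow, Finset.prod_mul_distrib]

theorem tensorPow_one [DecidableEq A] [DecidableEq B] : tensorPow (1 : BMat A B) n = 1 := by
  ext p q
  simp only [tensorPow, Matrix.of_apply, Matrix.one_apply, Finset.prod_ite_zero, Prod.ext_iff,
    funext_iff, Finset.mem_univ, true_implies, Finset.prod_const_one, forall_and]

theorem tensorPow_add (X Y : BMat A B) :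
    tensorPow (X + Y) n =
      ∑ t : Finset (Fin n), tensorProd (t.piecewise (fun _ => X) fun _ => Y) := by
  ext p q
  simp only [tensorPow, tensorProd, Matrix.sum_apply, Matrix.of_apply, Matrix.add_apply,
    Finset.prod_add, Finset.powerset_univ]
  refine Finset.sum_congr rfl fun t _ => ?_
  rw [← Finset.prod_mul_prod_compl t, ← Finset.compl_eq_univ_sdiff]
  congr 1
  · exact Finset.prod_congr rfl fun i hi => by rw [Finset.piecewise_eq_of_mem _ _ _ hi]
  · exact Finset.prod_congr rfl fun i hi => by
      rw [Finset.piecewise_eq_of_notMem _ _ _ (Finset.mem_compl.mp hi)]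

section Multiplication

variable [Fintype A] [Fintype B]

theorem prod_sum_eq_sum_prod {R : Type*} [CommSemiring R] (f : Fin n → A × B → R) :
    ∏ i, ∑ s, f i s = ∑ r : (Fin n → A) × (Fin n → B), ∏ i, f i (r.1 i, r.2 i) := by
  classical
  rw [Finset.prod_univ_sum, Fintype.piFinset_univ]
  exact Fintype.sum_equiv (Equiv.arrowProdEquivProdArrow (Fin n) (fun _ => A) (fun _ => B)) _ _
    fun _ => rfl

theorem tensorProd_mul (X Y : Fin n → BMat A B) :
    tensorProd X * tensorProd Y = tensorProd fun i => X i * Y i := by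
  ext p q
  simp only [Matrix.mul_apply, tensorProd, Matrix.of_apply, prod_sum_eq_sum_prod,
    Finset.prod_mul_distrib]

theorem tensorPow_mul (X Y : BMat A B) : tensorPow X n * tensorPow Y n = tensorPow (X * Y) n :=
  tensorProd_mul _ _

theorem trace_tensorPow (X : BMat A B) : (tensorPow X n).trace = X.trace ^ n := by
  have h := prod_sum_eq_sum_prod (n := n) fun _ (s : A × B) => X s s
  rw [Finset.prod_const, Finset.card_univ, Fintype.card_fin] at h
  exact h.symm

theorem hsInner_tensorPow {X Y : BMat A B} (hX : X.IsHermitian) (hY : Y.IsHermitian) :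
    hsInner (tensorPow X n) (tensorPow Y n) = hsInner X Y ^ n := by
  have h : (hsInner (tensorPow X n) (tensorPow Y n) : ℂ) = (hsInner X Y : ℂ) ^ n := by
    rw [coe_hsInner (isHermitian_tensorPow hX) (isHermitian_tensorPow hY), coe_hsInner hX hY,
      tensorPow_mul, trace_tensorPow]
  exact_mod_cast h

end Multiplication

section Positivity

variable [Finite A] [Finite B]

theorem posSemidef_tensorProd {X : Fin n → BMat A B} (hX : ∀ i, (X i).PosSemidef) :
    (tensorProd X).PosSemidef := by
  cases nonempty_fintype A
  cases nonempty_fintype B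
  choose C hC using fun i => exists_eq_conjTranspose_mul_self (hX i)
  rw [funext hC, ← tensorProd_mul, ← conjTranspose_tensorProd]
  exact Matrix.posSemidef_conjTranspose_mul_self _

theorem posSemidef_tensorPow {X : BMat A B} (hX : X.PosSemidef) : (tensorPow X n).PosSemidef :=
  posSemidef_tensorProd fun _ => hX

theorem tensorPow_mono {X Y : BMat A B} (hX : X.PosSemidef) (hXY : X ≤ Y) :
    tensorPow X n ≤ tensorPow Y n := by
  have hterm (t : Finset (Fin n)) :
      0 ≤ tensorProd (t.piecewise (fun _ => X) fun _ => Y - X) :=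
    (posSemidef_tensorProd fun i => by
      by_cases hi : i ∈ t <;> simp [hi, hX, Matrix.le_iff.mp hXY]).nonneg
  have hsum := Finset.single_le_sum (fun t _ => hterm t) (Finset.mem_univ Finset.univ)
  rwa [← tensorPow_add, add_sub_cancel, Finset.piecewise_univ] at hsum

end Positivity

variable [Fintype A] [Fintype B]

theorem isState_tensorPow {ρ : BMat A B} (hρ : IsState ρ) (n : ℕ) : IsState (tensorPow ρ n) :=
  ⟨posSemidef_tensorPow hρ.1, by rw [trace_tensorPow, hρ.2, one_pow]⟩

variable [DecidableEq A] [DecidableEq B]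

theorem norm_tensorPow_le (X : BMat A B) : ‖tensorPow X n‖ ≤ ‖X‖ ^ n := by
  have hXX : Xᴴ * X ≤ (‖X‖ ^ 2) • 1 := by
    rw [← Algebra.algebraMap_eq_smul_one]
    exact CStarAlgebra.star_mul_le_algebraMap_norm_sq
  have hpow : (tensorPow X n)ᴴ * tensorPow X n ≤ ((‖X‖ ^ n) ^ 2) • 1 := by
    simpa [conjTranspose_tensorPow, tensorPow_mul, tensorPow_smul, tensorPow_one, pow_right_comm]
      using tensorPow_mono (n := n) (Matrix.posSemidef_conjTranspose_mul_self X) hXX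
  refine le_of_sq_le_sq ?_ (by positivity)
  rw [sq ‖_‖, ← CStarRing.norm_star_mul_self]
  refine (CStarAlgebra.norm_le_iff_le_algebraMap _ (by positivity)
    (Matrix.posSemidef_conjTranspose_mul_self _).nonneg).mpr ?_
  rw [Algebra.algebraMap_eq_smul_one]
  exact hpow

theorem abs_tensorPow (X : BMat A B) : CFC.abs (tensorPow X n) = tensorPow (CFC.abs X) n := by
  have habs : (CFC.abs X).PosSemidef := Matrix.nonneg_iff_posSemidef.mp (CFC.abs_nonneg X)
  refine CFC.sqrt_unique ?_ (posSemidef_tensorPow habs).nonneg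
  rw [tensorPow_mul, CFC.abs_mul_abs, Matrix.star_eq_conjTranspose, Matrix.star_eq_conjTranspose,
    conjTranspose_tensorPow, tensorPow_mul]

theorem traceNorm_tensorPow (X : BMat A B) : traceNorm (tensorPow X n) = traceNorm X ^ n := by
  have habs : (CFC.abs X).PosSemidef := Matrix.nonneg_iff_posSemidef.mp (CFC.abs_nonneg X)
  have htrace : (CFC.abs X).trace = (traceNorm X : ℂ) :=
    Complex.ext rfl (Complex.nonneg_iff.mp habs.trace_nonneg).2.symm
  rw [traceNorm, abs_tensorPow, trace_tensorPow, htrace, ← Complex.ofReal_pow, Complex.ofReal_re]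

theorem tensorPow_mem_rainsSet {X : BMat A B} (hX : X ∈ rainsSet A B) :
    tensorPow X n ∈ rainsSet (Fin n → A) (Fin n → B) := by
  refine ⟨posSemidef_tensorPow hX.1, ?_⟩
  rw [partialTranspose_tensorPow, traceNorm_tensorPow]
  exact pow_le_one₀ (traceNorm_nonneg _) hX.2

theorem gammaRains_tensorPow_le {W : BMat A B} (hW : W.PosSemidef) (n : ℕ) :
    gammaRains (tensorPow W n) ≤ gammaRains W ^ n := by
  obtain ⟨Q, hQ, hWQ, hnorm⟩ := exists_norm_partialTranspose_eq_gammaRains hW.isHermitian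
  calc gammaRains (tensorPow W n) ≤ ‖partialTranspose _ _ (tensorPow Q n)‖ :=
        gammaRains_le_norm_partialTranspose (isHermitian_tensorPow hW.isHermitian)
          (isHermitian_tensorPow hQ) (tensorPow_mono hW hWQ)
    _ = ‖tensorPow (partialTranspose A B Q) n‖ := by rw [partialTranspose_tensorPow]
    _ ≤ gammaRains W ^ n := hnorm ▸ norm_tensorPow_le _

theorem hsInner_pow_le_gammaRains_tensorPow {W Y : BMat A B} (hW : W.IsHermitian)
    (hY : Y ∈ rainsSet A B) (n : ℕ) : hsInner W Y ^ n ≤ gammaRains (tensorPow W n) := by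
  rw [← hsInner_tensorPow hW hY.1.isHermitian]
  exact hsInner_le_gammaRains (isHermitian_tensorPow hW) (tensorPow_mem_rainsSet hY)

theorem pow_gammaRains_le {W : BMat A B} (hW : W.PosSemidef) (n : ℕ) :
    gammaRains W ^ n ≤ gammaRains (tensorPow W n) := by
  have hle {Y : BMat A B} (hY : Y ∈ rainsSet A B) :=
    hsInner_pow_le_gammaRains_tensorPow hW.isHermitian hY n
  rcases n.eq_zero_or_pos with rfl | hn
  · simpa using hle zero_mem_rainsSet
  · have h0 := gammaRains_nonneg (tensorPow W n)
    have hroot := Real.rpow_inv_natCast_pow h0 hn.ne'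
    rw [← hroot]
    refine pow_le_pow_left₀ (gammaRains_nonneg W) ?_ n
    refine (gammaRains_le_iff hW.isHermitian (Real.rpow_nonneg h0 _)).mpr fun Y hY => ?_
    exact le_of_pow_le_pow_left₀ hn.ne' (Real.rpow_nonneg h0 _) ((hle hY).trans hroot.ge)

theorem gammaRains_tensorPow {W : BMat A B} (hW : W.PosSemidef) (n : ℕ) :
    gammaRains (tensorPow W n) = gammaRains W ^ n :=
  (gammaRains_tensorPow_le hW n).antisymm (pow_gammaRains_le hW n)

end TensorPowers

section SupportProjector

variable {α : Type*} [Fintype α] [DecidableEq α]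

theorem toEuclideanCLM_supportProj (ρ : Matrix α α ℂ) :
    Matrix.toEuclideanCLM (n := α) (𝕜 := ℂ) (supportProj ρ) =
      (LinearMap.range (Matrix.toEuclideanCLM (n := α) (𝕜 := ℂ) ρ).toLinearMap).starProjection :=
  (Matrix.toEuclideanCLM (n := α) (𝕜 := ℂ)).apply_symm_apply _

theorem eq_of_toEuclideanCLM_eq {X Y : Matrix α α ℂ}
    (h : Matrix.toEuclideanCLM (n := α) (𝕜 := ℂ) X = Matrix.toEuclideanCLM (n := α) (𝕜 := ℂ) Y) :
    X = Y :=
  (Matrix.toEuclideanCLM (n := α) (𝕜 := ℂ)).injective h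

theorem isStarProjection_supportProj (ρ : Matrix α α ℂ) : IsStarProjection (supportProj ρ) where
  isIdempotentElem := eq_of_toEuclideanCLM_eq <| by
    rw [map_mul, toEuclideanCLM_supportProj, isStarProjection_starProjection.isIdempotentElem.eq]
  isSelfAdjoint := eq_of_toEuclideanCLM_eq <| by
    rw [map_star, toEuclideanCLM_supportProj, isStarProjection_starProjection.isSelfAdjoint.star_eq]

theorem isHermitian_supportProj (ρ : Matrix α α ℂ) : (supportProj ρ).IsHermitian :=
  (isStarProjection_supportProj ρ).isSelfAdjoint

theorem posSemidef_supportProj (ρ : Matrix α α ℂ) : (supportProj ρ).PosSemidef :=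
  Matrix.nonneg_iff_posSemidef.mp (isStarProjection_supportProj ρ).nonneg

theorem supportProj_mul (ρ : Matrix α α ℂ) : supportProj ρ * ρ = ρ := by
  apply eq_of_toEuclideanCLM_eq
  rw [map_mul, toEuclideanCLM_supportProj]
  ext1 v
  exact Submodule.starProjection_eq_self_iff.mpr ⟨v, rfl⟩

theorem exists_supportProj_eq_mul (ρ : Matrix α α ℂ) : ∃ Z, supportProj ρ = ρ * Z := by
  let f := (Matrix.toEuclideanCLM (n := α) (𝕜 := ℂ) ρ).toLinearMap
  obtain ⟨g, hg⟩ := Module.projective_lifting_property f.rangeRestrict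
    (LinearMap.range f).orthogonalProjectionOnto.toLinearMap f.surjective_rangeRestrict
  refine ⟨(Matrix.toEuclideanCLM (n := α) (𝕜 := ℂ)).symm (LinearMap.toContinuousLinearMap g), ?_⟩
  apply eq_of_toEuclideanCLM_eq
  rw [map_mul, (Matrix.toEuclideanCLM (n := α) (𝕜 := ℂ)).apply_symm_apply,
    toEuclideanCLM_supportProj]
  ext1 v
  exact congrArg Subtype.val (LinearMap.congr_fun hg v).symm

theorem eq_supportProj {ρ P : Matrix α α ℂ} (hP : P.IsHermitian) (hPρ : P * ρ = ρ)
    (hZ : ∃ Z, P = ρ * Z) : P = supportProj ρ := by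
  obtain ⟨Z, hZ⟩ := hZ
  obtain ⟨Y, hY⟩ := exists_supportProj_eq_mul ρ
  have hSP : supportProj ρ * P = P := by rw [hZ, ← Matrix.mul_assoc, supportProj_mul]
  have hPS : P * supportProj ρ = supportProj ρ := by rw [hY, ← Matrix.mul_assoc, hPρ]
  calc P = (supportProj ρ * P)ᴴ := by rw [hSP, hP.eq]
    _ = supportProj ρ := by
      rw [Matrix.conjTranspose_mul, hP.eq, (isHermitian_supportProj ρ).eq, hPS]

theorem supportProj_tensorPow {A B : Type*} [Fintype A] [Fintype B] [DecidableEq A]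
    [DecidableEq B] (ρ : BMat A B) (n : ℕ) :
    supportProj (tensorPow ρ n) = tensorPow (supportProj ρ) n := by
  obtain ⟨Z, hZ⟩ := exists_supportProj_eq_mul ρ
  refine (eq_supportProj (isHermitian_tensorPow (isHermitian_supportProj ρ)) ?_
    ⟨tensorPow Z n, ?_⟩).symm
  · rw [tensorPow_mul, supportProj_mul]
  · rw [tensorPow_mul, ← hZ]

theorem hsInner_supportProj (ρ : Matrix α α ℂ) : hsInner (supportProj ρ) ρ = ρ.trace.re := by
  rw [hsInner, (isHermitian_supportProj ρ).eq, supportProj_mul]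

theorem supportProj_ne_zero {ρ : Matrix α α ℂ} (hρ : ρ ≠ 0) : supportProj ρ ≠ 0 := fun h =>
  hρ (by rw [← supportProj_mul ρ, h, zero_mul])

theorem supportProj_le {ρ E : Matrix α α ℂ} (hρ : IsState ρ) (hE : E.PosSemidef) (hE1 : E ≤ 1)
    (hρE : 1 ≤ hsInner E ρ) : supportProj ρ ≤ E := by
  have hS := isHermitian_supportProj ρ
  have hzero : hsInner (1 - E) ρ = 0 := by
    refine le_antisymm ?_ (hsInner_nonneg (Matrix.le_iff.mp hE1) hρ.1)
    rw [hsInner_sub_left, hsInner_one_left, hρ.2, Complex.one_re]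
    linarith
  have hES : E * supportProj ρ = supportProj ρ := by
    obtain ⟨Z, hZ⟩ := exists_supportProj_eq_mul ρ
    have hmul := mul_eq_zero_of_hsInner_eq_zero (Matrix.le_iff.mp hE1) hρ.1 hzero
    rw [sub_mul, one_mul, sub_eq_zero] at hmul
    rw [hZ, ← Matrix.mul_assoc, ← hmul]
  have hSE : supportProj ρ * E = supportProj ρ := by
    simpa [hE.isHermitian.eq, hS.eq] using congrArg Matrix.conjTranspose hES
  have hsub : E - supportProj ρ = (1 - supportProj ρ)ᴴ * E * (1 - supportProj ρ) := by
    rw [Matrix.conjTranspose_sub, Matrix.conjTranspose_one, hS.eq, sub_mul, hSE, one_mul, mul_sub,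
      mul_one, sub_mul, hES, (isStarProjection_supportProj ρ).isIdempotentElem.eq, sub_self,
      sub_zero]
  rw [Matrix.le_iff, hsub]
  exact hE.conjTranspose_mul_mul_same _

end SupportProjector

section CompletelyPositive

variable {α β : Type*}

theorem IsCP.posSemidef_map {Λ : Matrix α α ℂ →ₗ[ℂ] Matrix β β ℂ} (hΛ : IsCP Λ)
    {X : Matrix α α ℂ} (hX : X.PosSemidef) : (Λ X).PosSemidef :=
  (hΛ 1 (X.submatrix Prod.snd Prod.snd) (hX.submatrix _)).submatrix fun b => (0, b)

theorem IsCP.add {Λ Λ' : Matrix α α ℂ →ₗ[ℂ] Matrix β β ℂ} (hΛ : IsCP Λ) (hΛ' : IsCP Λ') :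
    IsCP (Λ + Λ') := fun k X hX => (hΛ k X hX).add (hΛ' k X hX)

variable [Fintype α]

/-- The map `X ↦ Tr (E X) σ`, which performs the test `E` and prepares the state `σ` if the test
is passed. -/
def measurePrepare (E : Matrix α α ℂ) (σ : Matrix β β ℂ) : Matrix α α ℂ →ₗ[ℂ] Matrix β β ℂ :=
  (Matrix.traceLinearMap α ℂ ℂ ∘ₗ LinearMap.mulLeft ℂ E).smulRight σ

theorem measurePrepare_apply (E X : Matrix α α ℂ) (σ : Matrix β β ℂ) :
    measurePrepare E σ X = (E * X).trace • σ := rfl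

theorem measurePrepare_eq_hsInner_smul {E X : Matrix α α ℂ} (hE : E.IsHermitian)
    (hX : X.IsHermitian) (σ : Matrix β β ℂ) : measurePrepare E σ X = hsInner E X • σ := by
  rw [measurePrepare_apply, ← coe_hsInner hE hX, Complex.coe_smul]

theorem one_kronecker_mul_mul_apply {κ : Type*} [Fintype κ] [DecidableEq κ] (C D : Matrix α α ℂ)
    (X : Matrix (κ × α) (κ × α) ℂ) (p q : κ × α) :
    (((1 : Matrix κ κ ℂ) ⊗ₖ C) * X * ((1 : Matrix κ κ ℂ) ⊗ₖ D)) p q =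
      (C * Matrix.of (fun a b => X (p.1, a) (q.1, b)) * D) p.2 q.2 := by
  simp [Matrix.mul_apply, Fintype.sum_prod_type, Matrix.one_apply, ite_mul, mul_ite,
    Finset.sum_ite_irrel]

theorem isCP_measurePrepare [Finite β] {E : Matrix α α ℂ} {σ : Matrix β β ℂ} (hE : E.PosSemidef)
    (hσ : σ.PosSemidef) : IsCP (measurePrepare E σ) := by
  intro k X hX
  obtain ⟨C, rfl⟩ := exists_eq_conjTranspose_mul_self hE
  let Y := ((1 : Matrix (Fin k) (Fin k) ℂ) ⊗ₖ C) * X * ((1 : Matrix (Fin k) (Fin k) ℂ) ⊗ₖ C)ᴴ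
  have hY : Y.PosSemidef := hX.mul_mul_conjTranspose_same _
  let M : Matrix (Fin k) (Fin k) ℂ := ∑ c, Y.submatrix (·, c) (·, c)
  have hM : M.PosSemidef := Matrix.posSemidef_sum _ fun c _ => hY.submatrix (·, c)
  have hampl : ampliation (Fin k) (measurePrepare (Cᴴ * C) σ) X = M ⊗ₖ σ := by
    ext p q
    simp only [ampliation, Matrix.of_apply, measurePrepare_apply, Matrix.smul_apply, smul_eq_mul,
      Matrix.kroneckerMap_apply, trace_conjTranspose_mul_self_mul]
    simp only [M, Y, Matrix.sum_apply, Matrix.submatrix_apply, Matrix.conjTranspose_kronecker,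
      Matrix.conjTranspose_one, one_kronecker_mul_mul_apply]
    rfl
  rw [hampl]
  exact hM.kronecker hσ

variable [DecidableEq α]

/-- The two-outcome measure-and-prepare map, which performs the test `E` and prepares the state `σ`
if it is passed and the state `τ` if it is failed. -/
def testAndPrepare (E : Matrix α α ℂ) (σ τ : Matrix β β ℂ) : Matrix α α ℂ →ₗ[ℂ] Matrix β β ℂ :=
  measurePrepare E σ + measurePrepare (1 - E) τ

theorem testAndPrepare_apply {E X : Matrix α α ℂ} (hE : E.IsHermitian) (hX : X.IsHermitian)
    (σ τ : Matrix β β ℂ) :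
    testAndPrepare E σ τ X = hsInner E X • σ + hsInner (1 - E) X • τ := by
  rw [testAndPrepare, LinearMap.add_apply, measurePrepare_eq_hsInner_smul hE hX,
    measurePrepare_eq_hsInner_smul (Matrix.isHermitian_one.sub hE) hX]

theorem isCPTP_testAndPrepare [Fintype β] {E : Matrix α α ℂ} (hE : E.PosSemidef) (hE1 : E ≤ 1)
    {σ τ : Matrix β β ℂ} (hσ : IsState σ) (hτ : IsState τ) : IsCPTP (testAndPrepare E σ τ) := by
  refine ⟨(isCP_measurePrepare hE hσ.1).add (isCP_measurePrepare (Matrix.le_iff.mp hE1) hτ.1),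
    fun X => ?_⟩
  rw [testAndPrepare, LinearMap.add_apply, measurePrepare_apply, measurePrepare_apply,
    Matrix.trace_add, Matrix.trace_smul, Matrix.trace_smul, hσ.2, hτ.2, ← add_smul,
    ← Matrix.trace_add, ← add_mul, add_sub_cancel, one_mul, smul_eq_mul, mul_one]

variable [Fintype β] [DecidableEq β]

theorem traceNorm_map_le {Λ : Matrix α α ℂ →ₗ[ℂ] Matrix β β ℂ}
    (hpos : ∀ X : Matrix α α ℂ, X.PosSemidef → (Λ X).PosSemidef)
    (htrace : ∀ X, (Λ X).trace = X.trace) {X : Matrix α α ℂ} (hX : X.IsHermitian) :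
    traceNorm (Λ X) ≤ traceNorm X := by
  have hP : (Λ X⁺).PosSemidef := hpos _ (Matrix.nonneg_iff_posSemidef.mp (CFC.posPart_nonneg X))
  have hN : (Λ X⁻).PosSemidef := hpos _ (Matrix.nonneg_iff_posSemidef.mp (CFC.negPart_nonneg X))
  calc traceNorm (Λ X) = traceNorm (Λ X⁺ + (-1 : ℝ) • Λ X⁻) := by
        rw [neg_one_smul, ← sub_eq_add_neg, ← map_sub, CFC.posPart_sub_negPart X hX]
    _ ≤ traceNorm (Λ X⁺) + traceNorm ((-1 : ℝ) • Λ X⁻) :=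
        traceNorm_add_le hP.isHermitian (isHermitian_real_smul hN.isHermitian _)
    _ = traceNorm X := by
        rw [traceNorm_smul, abs_neg, abs_one, one_mul, traceNorm_of_posSemidef hP,
          traceNorm_of_posSemidef hN, htrace, htrace, traceNorm_eq_trace_posPart_add hX]

end CompletelyPositive

section RainsPreserving

variable {A B A' B' : Type*} [Fintype A] [Fintype B] [Fintype A'] [Fintype B'] [DecidableEq A]
  [DecidableEq B] [DecidableEq A'] [DecidableEq B']

theorem pptOperations_subset_rainsPreserving :
    pptOperations A B A' B' ⊆ rainsPreserving A B A' B' := by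
  rintro Λ ⟨hΛ, hT⟩
  refine ⟨hΛ, fun X hX => ⟨hΛ.1.posSemidef_map hX.1, ?_⟩⟩
  refine (traceNorm_map_le (fun _ => hT.posSemidef_map) (fun Y => ?_)
    (isHermitian_partialTranspose hX.1.isHermitian)).trans hX.2
  simp only [LinearMap.comp_apply, trace_partialTranspose, hΛ.2]

theorem hsInner_one_le_one_of_mem_rainsSet {X : BMat A B} (hX : X ∈ rainsSet A B) :
    hsInner 1 X ≤ 1 :=
  (hsInner_le_gammaRains Matrix.isHermitian_one hX).trans
    (gammaRains_le_one Matrix.isHermitian_one le_rfl)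

end RainsPreserving

section MaximallyEntangled

variable {m : ℕ}

/-- The swap operator on `ℂ^m ⊗ ℂ^m`, which is up to normalization the partial transpose of
`Ψ_m`. -/
def swapOp (m : ℕ) : BMat (Fin m) (Fin m) :=
  Matrix.of fun p q => if p = q.swap then 1 else 0

theorem isHermitian_swapOp : (swapOp m).IsHermitian := by
  ext p q
  simp [swapOp, Prod.ext_iff, eq_comm, and_comm]

theorem swapOp_mul_self : swapOp m * swapOp m = 1 := by
  ext p q
  have hswap (r : Fin m × Fin m) : p = r.swap ↔ r = p.swap := by
    rw [← Prod.swap_inj, Prod.swap_swap, eq_comm]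
  simp [swapOp, Matrix.mul_apply, Matrix.one_apply, hswap, eq_comm]

theorem trace_swapOp : (swapOp m).trace = m := by
  have hdiag (i j : Fin m) : (i, j) = (j, i) ↔ i = j := by simp [Prod.ext_iff, eq_comm]
  simp [swapOp, Matrix.trace, -Finset.sum_boole, Fintype.sum_prod_type, hdiag]

theorem norm_swapOp_le_one : ‖swapOp m‖ ≤ 1 := by
  have hone : ‖(1 : BMat (Fin m) (Fin m))‖ ≤ 1 := norm_one_le
  have hsq := CStarRing.norm_star_mul_self (x := swapOp m)
  rw [Matrix.star_eq_conjTranspose, isHermitian_swapOp.eq, swapOp_mul_self] at hsq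
  nlinarith [norm_nonneg (swapOp m)]

theorem posSemidef_one_sub_swapOp : (1 - swapOp m).PosSemidef :=
  Matrix.le_iff.mp (le_one_of_norm_le_one isHermitian_swapOp norm_swapOp_le_one)

theorem posSemidef_one_add_swapOp : (1 + swapOp m).PosSemidef := by
  simpa using Matrix.le_iff.mp
    (le_one_of_norm_le_one isHermitian_swapOp.neg ((norm_neg _).trans_le norm_swapOp_le_one))

theorem trace_one_prod_fin : (1 : BMat (Fin m) (Fin m)).trace = (m : ℂ) ^ 2 := by
  simp [sq]

theorem traceNorm_one_add_swapOp : traceNorm (1 + swapOp m) = (m : ℝ) ^ 2 + m := by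
  rw [traceNorm_of_posSemidef posSemidef_one_add_swapOp, Matrix.trace_add, trace_one_prod_fin,
    trace_swapOp]
  norm_cast

theorem traceNorm_one_sub_swapOp : traceNorm (1 - swapOp m) = (m : ℝ) ^ 2 - m := by
  rw [traceNorm_of_posSemidef posSemidef_one_sub_swapOp, Matrix.trace_sub, trace_one_prod_fin,
    trace_swapOp]
  norm_cast

theorem partialTranspose_maxEnt :
    partialTranspose _ _ (maxEnt m) = (m : ℝ)⁻¹ • swapOp m := by
  ext p q
  have hsq : (Real.sqrt m : ℂ)⁻¹ * (Real.sqrt m : ℂ)⁻¹ = (m : ℂ)⁻¹ := by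
    rw [← mul_inv, ← Complex.ofReal_mul, Real.mul_self_sqrt m.cast_nonneg, Complex.ofReal_natCast]
  by_cases h₁ : p.1 = q.2 <;> by_cases h₂ : p.2 = q.1 <;>
    simp [partialTranspose_apply, maxEnt, Matrix.vecMulVec_apply, maxEntVec, swapOp, Prod.ext_iff,
      h₁, h₂, hsq, eq_comm (a := q.1)]

theorem posSemidef_maxEnt : (maxEnt m).PosSemidef :=
  Matrix.posSemidef_vecMulVec_self_star _

theorem trace_maxEnt (hm : m ≠ 0) : (maxEnt m).trace = 1 := by
  rw [← trace_partialTranspose, partialTranspose_maxEnt, Matrix.trace_smul, trace_swapOp]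
  simp [hm]

theorem isState_maxEnt (hm : m ≠ 0) : IsState (maxEnt m) := ⟨posSemidef_maxEnt, trace_maxEnt hm⟩

theorem isStarProjection_maxEnt (hm : m ≠ 0) : IsStarProjection (maxEnt m) where
  isIdempotentElem := by
    have hunit : star (maxEntVec m) ⬝ᵥ maxEntVec m = 1 := by
      rw [← trace_maxEnt hm, maxEnt, Matrix.trace_vecMulVec, dotProduct_comm]
    rw [IsIdempotentElem, maxEnt, Matrix.vecMulVec_mul_vecMulVec, hunit, one_smul]
  isSelfAdjoint := posSemidef_maxEnt.isHermitian

theorem maxEnt_le_one (hm : m ≠ 0) : maxEnt m ≤ 1 := (isStarProjection_maxEnt hm).le_one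

theorem hsInner_maxEnt_self (hm : m ≠ 0) : hsInner (maxEnt m) (maxEnt m) = 1 := by
  rw [hsInner, posSemidef_maxEnt.isHermitian.eq, (isStarProjection_maxEnt hm).isIdempotentElem.eq,
    trace_maxEnt hm, Complex.one_re]

theorem hsInner_maxEnt_le {X : BMat (Fin m) (Fin m)} (hX : X ∈ rainsSet (Fin m) (Fin m)) :
    hsInner (maxEnt m) X ≤ 1 / m := by
  refine (hsInner_le_norm_partialTranspose posSemidef_maxEnt.isHermitian le_rfl hX).trans ?_
  rw [partialTranspose_maxEnt, norm_smul, Real.norm_of_nonneg (by positivity), one_div]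
  exact mul_le_of_le_one_right (by positivity) norm_swapOp_le_one

/-- The isotropic state orthogonal to `Ψ_m`. It is a state only for `m > 1`, and `0` for
`m = 1`. -/
def maxEntCompl (m : ℕ) : BMat (Fin m) (Fin m) := ((m : ℝ) ^ 2 - 1)⁻¹ • (1 - maxEnt m)

theorem isState_maxEntCompl (hm : 1 < m) : IsState (maxEntCompl m) := by
  have hm1 : (1 : ℝ) < m := Nat.one_lt_cast.mpr hm
  have hm2 : (m : ℂ) ^ 2 - 1 ≠ 0 := by
    exact_mod_cast (sub_pos.mpr (one_lt_pow₀ hm1 two_ne_zero)).ne'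
  refine ⟨(Matrix.le_iff.mp (maxEnt_le_one (by lia))).smul
    (inv_nonneg.mpr (sub_nonneg.mpr (one_le_pow₀ hm1.le))), ?_⟩
  rw [maxEntCompl, Matrix.trace_smul, Matrix.trace_sub, trace_one_prod_fin, trace_maxEnt (by lia),
    Complex.real_smul]
  push_cast
  exact inv_mul_cancel₀ hm2

theorem partialTranspose_isotropic (hm : 1 < m) (a b : ℝ) :
    partialTranspose _ _ (a • maxEnt m + b • maxEntCompl m) =
      ((a / m + b / (m * (m + 1))) / 2) • (1 + swapOp m) +
        ((b / (m * (m - 1)) - a / m) / 2) • (1 - swapOp m) := by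
  have hm1 : (0 : ℝ) < m - 1 := sub_pos.mpr (Nat.one_lt_cast.mpr hm)
  have : (0 : ℝ) < m := by linarith
  rw [maxEntCompl, map_add, partialTranspose_real_smul, partialTranspose_real_smul,
    partialTranspose_real_smul, map_sub, partialTranspose_one, partialTranspose_maxEnt,
    show (m : ℝ) ^ 2 - 1 = (m - 1) * (m + 1) by ring]
  match_scalars <;> field_simp <;> ring

theorem traceNorm_partialTranspose_isotropic_le (hm : 1 < m) {a b : ℝ} (ha : 0 ≤ a) (hb : 0 ≤ b) :
    traceNorm (partialTranspose _ _ (a • maxEnt m + b • maxEntCompl m)) ≤ max (a * m) (a + b) := by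
  have hm1 : (0 : ℝ) < m - 1 := sub_pos.mpr (Nat.one_lt_cast.mpr hm)
  have : (0 : ℝ) < m := by linarith
  have hplus : |(a / m + b / (m * (m + 1))) / 2| * ((m : ℝ) ^ 2 + m) = (a * (m + 1) + b) / 2 := by
    rw [abs_of_nonneg (by positivity)]
    field_simp
  have hminus : |(b / (m * (m - 1)) - a / m) / 2| * ((m : ℝ) ^ 2 - m) = |b - a * (m - 1)| / 2 := by
    have hpos : (0 : ℝ) < m ^ 2 - m := by nlinarith
    have heq : (b / (m * (m - 1)) - a / m) / 2 * ((m : ℝ) ^ 2 - m) = (b - a * (m - 1)) / 2 := by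
      field_simp
    simpa only [abs_mul, abs_div, abs_two, abs_of_pos hpos] using congrArg abs heq
  rw [partialTranspose_isotropic hm]
  refine (traceNorm_add_le (isHermitian_real_smul posSemidef_one_add_swapOp.isHermitian _)
    (isHermitian_real_smul posSemidef_one_sub_swapOp.isHermitian _)).trans ?_
  rw [traceNorm_smul, traceNorm_smul, traceNorm_one_add_swapOp, traceNorm_one_sub_swapOp, hplus,
    hminus]
  rcases abs_cases (b - a * (m - 1)) with ⟨habs, -⟩ | ⟨habs, -⟩ <;> rw [habs]
  · exact le_max_of_le_right (by linarith)
  · exact le_max_of_le_left (by linarith)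

theorem partialTranspose_maxEnt_one : partialTranspose _ _ (maxEnt 1) = maxEnt 1 := by
  ext p q
  rw [partialTranspose_apply, Subsingleton.elim (p.1, q.2) p, Subsingleton.elim (q.1, p.2) q]

theorem exists_isState_isotropic_mem_rainsSet (hm : 1 ≤ m) : ∃ σ, IsState σ ∧
    ∀ a b : ℝ, 0 ≤ a → 0 ≤ b → a + b ≤ 1 → a ≤ 1 / m →
      a • maxEnt m + b • σ ∈ rainsSet (Fin m) (Fin m) := by
  rcases hm.eq_or_lt with rfl | hm1
  · refine ⟨maxEnt 1, isState_maxEnt one_ne_zero, fun a b ha hb hab _ => ?_⟩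
    rw [← add_smul]
    refine smul_mem_rainsSet posSemidef_maxEnt (add_nonneg ha hb) ?_
    rwa [partialTranspose_maxEnt_one, traceNorm_of_posSemidef posSemidef_maxEnt,
      trace_maxEnt one_ne_zero, Complex.one_re, mul_one]
  · have hσ := isState_maxEntCompl hm1
    refine ⟨maxEntCompl m, hσ, fun a b ha hb hab ham => ?_⟩
    rw [le_div_iff₀ (by positivity)] at ham
    exact ⟨(posSemidef_maxEnt.smul ha).add (hσ.1.smul hb),
      (traceNorm_partialTranspose_isotropic_le hm1 ha hb).trans (max_le ham hab)⟩

end MaximallyEntangled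

section OneShot

theorem exists_effect_hsInner_eq {α β : Type*} [Fintype α] [DecidableEq α] [Fintype β]
    [DecidableEq β] {Λ : Matrix α α ℂ →ₗ[ℂ] Matrix β β ℂ} (hΛ : IsCPTP Λ) {F : Matrix β β ℂ}
    (hF : F.PosSemidef) (hF1 : F ≤ 1) :
    ∃ E : Matrix α α ℂ, E.PosSemidef ∧ E ≤ 1 ∧
      ∀ X, X.IsHermitian → hsInner E X = hsInner F (Λ X) := by
  let f : selfAdjoint.submodule ℝ (Matrix α α ℂ) →ₗ[ℝ] ℝ :=
    { toFun := fun X => hsInner F (Λ X)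
      map_add' := fun X Y => by rw [Submodule.coe_add, map_add, hsInner_add_right]
      map_smul' := fun c X => by
        rw [Submodule.coe_smul, LinearMap.map_smul_of_tower, hsInner_smul_right]
        rfl }
  obtain ⟨E, hE, hfE⟩ := exists_hsInner_eq f
  have hdual (X : Matrix α α ℂ) (hX : X.IsHermitian) : hsInner E X = hsInner F (Λ X) :=
    (hfE X hX).symm
  refine ⟨E, posSemidef_of_hsInner_nonneg hE fun P hP => ?_, Matrix.le_iff.mpr <|
    posSemidef_of_hsInner_nonneg (Matrix.isHermitian_one.sub hE) fun P hP => ?_, hdual⟩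
  · rw [hdual P hP.isHermitian]
    exact hsInner_nonneg hF (hΛ.1.posSemidef_map hP)
  · have hle := hsInner_mono_left hF1 (hΛ.1.posSemidef_map hP)
    rw [hsInner_one_left, hΛ.2] at hle
    rwa [hsInner_sub_left, hsInner_one_left, hdual P hP.isHermitian, sub_nonneg]

variable {A B : Type*} [Fintype A] [Fintype B] [DecidableEq A] [DecidableEq B]

/-- The effects `0 ≤ E ≤ 1` that occur with probability at most `c` on the Rains set. For
`c = 1 / m` they are the tests for `Ψ_m` after a Rains-preserving operation. -/
def rainsEffects (A B : Type*) [Fintype A] [Fintype B] [DecidableEq A] [DecidableEq B] (c : ℝ) :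
    Set (BMat A B) :=
  {E | E.PosSemidef ∧ E ≤ 1 ∧ ∀ Y ∈ rainsSet A B, hsInner E Y ≤ c}

theorem zero_mem_rainsEffects {c : ℝ} (hc : 0 ≤ c) : 0 ∈ rainsEffects A B c :=
  ⟨Matrix.PosSemidef.zero, zero_le_one, fun _ _ => by simpa [hsInner] using hc⟩

theorem isCompact_rainsEffects (c : ℝ) : IsCompact (rainsEffects A B c) := by
  have hclosed : IsClosed (rainsEffects A B c) := by
    have heq : rainsEffects A B c =
        Set.Icc 0 1 ∩ ⋂ Y ∈ rainsSet A B, {E | hsInner E Y ≤ c} := by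
      ext E
      simp [rainsEffects, and_assoc, Matrix.nonneg_iff_posSemidef]
    rw [heq]
    exact isClosed_Icc.inter (isClosed_biInter fun Y _ =>
      isClosed_le (continuous_hsInner_left Y) continuous_const)
  exact (isCompact_isHermitian_norm_le (A × B) 1).of_isClosed_subset hclosed fun E hE =>
    ⟨hE.1.isHermitian, (CStarAlgebra.norm_le_one_iff_of_nonneg E hE.1.nonneg).mpr hE.2.1⟩

variable {m : ℕ} {ρ : BMat A B}

theorem exists_mem_rainsEffects_hsInner_eq (hm : 1 ≤ m)
    {Λ : BMat A B →ₗ[ℂ] BMat (Fin m) (Fin m)} (hΛ : Λ ∈ rainsPreserving A B (Fin m) (Fin m)) :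
    ∃ E ∈ rainsEffects A B (1 / m),
      ∀ X, X.IsHermitian → hsInner E X = hsInner (Λ X) (maxEnt m) := by
  obtain ⟨E, hE, hE1, hdual⟩ :=
    exists_effect_hsInner_eq hΛ.1 posSemidef_maxEnt (maxEnt_le_one (by lia))
  refine ⟨E, ⟨hE, hE1, fun Y hY => ?_⟩, fun X hX => by rw [hdual X hX, hsInner_comm]⟩
  rw [hdual Y hY.1.isHermitian]
  exact hsInner_maxEnt_le (hΛ.2 Y hY)

theorem testAndPrepare_mem_rainsPreserving {E : BMat A B} (hE : E ∈ rainsEffects A B (1 / m))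
    {σ : BMat (Fin m) (Fin m)} (hm : 1 ≤ m) (hσ : IsState σ)
    (hmix : ∀ a b : ℝ, 0 ≤ a → 0 ≤ b → a + b ≤ 1 → a ≤ 1 / m →
      a • maxEnt m + b • σ ∈ rainsSet (Fin m) (Fin m)) :
    testAndPrepare E (maxEnt m) σ ∈ rainsPreserving A B (Fin m) (Fin m) := by
  refine ⟨isCPTP_testAndPrepare hE.1 hE.2.1 (isState_maxEnt (by lia)) hσ, fun X hX => ?_⟩
  rw [testAndPrepare_apply hE.1.isHermitian hX.1.isHermitian]
  refine hmix _ _ (hsInner_nonneg hE.1 hX.1)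
    (hsInner_nonneg (Matrix.le_iff.mp hE.2.1) hX.1) ?_ (hE.2.2 X hX)
  rw [← hsInner_add_left, add_sub_cancel]
  exact hsInner_one_le_one_of_mem_rainsSet hX

theorem exists_mem_rainsPreserving_le_hsInner {E : BMat A B} (hE : E ∈ rainsEffects A B (1 / m))
    (hm : 1 ≤ m) (hρ : ρ.PosSemidef) : ∃ Λ ∈ rainsPreserving A B (Fin m) (Fin m),
      hsInner E ρ ≤ hsInner (Λ ρ) (maxEnt m) := by
  obtain ⟨σ, hσ, hmix⟩ := exists_isState_isotropic_mem_rainsSet hm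
  refine ⟨_, testAndPrepare_mem_rainsPreserving hE hm hσ hmix, ?_⟩
  rw [testAndPrepare_apply hE.1.isHermitian hρ.isHermitian, hsInner_add_left, hsInner_smul_left,
    hsInner_smul_left, hsInner_maxEnt_self (by lia), mul_one]
  exact le_add_of_nonneg_right (mul_nonneg (hsInner_nonneg (Matrix.le_iff.mp hE.2.1) hρ)
    (hsInner_nonneg hσ.1 posSemidef_maxEnt))

theorem isGreatest_fidelity_rainsPreserving (hm : 1 ≤ m) (hρ : ρ.PosSemidef) :
    IsGreatest ((hsInner · ρ) '' rainsEffects A B (1 / m))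
      (fidelity (rainsPreserving A B (Fin m) (Fin m)) ρ) := by
  obtain ⟨E, hE, hmax⟩ := (isCompact_rainsEffects (A := A) (B := B) (1 / m)).exists_isMaxOn
    ⟨0, zero_mem_rainsEffects (by positivity)⟩ (continuous_hsInner_left ρ).continuousOn
  obtain ⟨Λ, hΛ, hEΛ⟩ := exists_mem_rainsPreserving_le_hsInner hE hm hρ
  have hle : ∀ r ∈ (fun Λ => hsInner (Λ ρ) (maxEnt m)) '' rainsPreserving A B (Fin m) (Fin m),
      r ≤ hsInner E ρ := by
    rintro _ ⟨Λ', hΛ', rfl⟩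
    obtain ⟨E', hE', hdual⟩ := exists_mem_rainsEffects_hsInner_eq hm hΛ'
    exact (hdual ρ hρ.isHermitian).symm.trans_le (hmax hE')
  have hfid : fidelity (rainsPreserving A B (Fin m) (Fin m)) ρ = hsInner E ρ :=
    le_antisymm (csSup_le ⟨_, Λ, hΛ, rfl⟩ hle)
      (le_csSup_of_le ⟨_, hle⟩ ⟨Λ, hΛ, rfl⟩ hEΛ)
  rw [hfid]
  exact ⟨⟨E, hE, rfl⟩, by rintro _ ⟨E', hE', rfl⟩; exact hmax hE'⟩

theorem one_le_fidelity_rainsPreserving_iff (hm : 1 ≤ m) (hρ : IsState ρ) :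
    1 ≤ fidelity (rainsPreserving A B (Fin m) (Fin m)) ρ ↔
      gammaRains (supportProj ρ) ≤ 1 / m := by
  have hfid := isGreatest_fidelity_rainsPreserving hm hρ.1
  rw [gammaRains_le_iff (isHermitian_supportProj ρ) (by positivity)]
  constructor
  · intro h Y hY
    obtain ⟨E, ⟨hE, hE1, hEY⟩, hEρ⟩ := hfid.1
    have hle : supportProj ρ ≤ E := supportProj_le hρ hE hE1 (h.trans_eq hEρ.symm)
    exact (hsInner_mono_left hle hY.1).trans (hEY Y hY)
  · intro h
    have hmem : supportProj ρ ∈ rainsEffects A B (1 / m) :=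
      ⟨posSemidef_supportProj ρ, (isStarProjection_supportProj ρ).le_one, h⟩
    have hone : hsInner (supportProj ρ) ρ = 1 := by
      rw [hsInner_supportProj, hρ.2, Complex.one_re]
    exact hone.symm.trans_le (hfid.2 ⟨_, hmem, rfl⟩)

end OneShot

section Monotonicity

variable {A B : Type*} [Fintype A] [Fintype B] {ρ : BMat A B}

theorem fidelity_mono {m : ℕ} {𝒪 𝒪' : Set (BMat A B →ₗ[ℂ] BMat (Fin m) (Fin m))} (hm : m ≠ 0)
    (h : 𝒪 ⊆ 𝒪') (h𝒪' : ∀ Λ ∈ 𝒪', IsCPTP Λ) (hρ : IsState ρ) : fidelity 𝒪 ρ ≤ fidelity 𝒪' ρ := by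
  have hbdd : BddAbove ((fun Λ => hsInner (Λ ρ) (maxEnt m)) '' 𝒪') := by
    refine ⟨1, ?_⟩
    rintro _ ⟨Λ, hΛ, rfl⟩
    have hle := hsInner_mono_left (maxEnt_le_one hm) ((h𝒪' Λ hΛ).1.posSemidef_map hρ.1)
    rwa [hsInner_one_left, (h𝒪' Λ hΛ).2, hρ.2, Complex.one_re, hsInner_comm] at hle
  refine Real.sSup_le ?_ (Real.sSup_nonneg ?_)
  · rintro _ ⟨Λ, hΛ, rfl⟩
    exact le_csSup hbdd ⟨Λ, h hΛ, rfl⟩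
  · rintro _ ⟨Λ, hΛ, rfl⟩
    exact hsInner_nonneg ((h𝒪' Λ hΛ).1.posSemidef_map hρ.1) posSemidef_maxEnt

theorem oneShotDistillable_mono {𝒪 𝒪' : ∀ m : ℕ, Set (BMat A B →ₗ[ℂ] BMat (Fin m) (Fin m))}
    (h : ∀ m, 𝒪 m ⊆ 𝒪' m) (h𝒪' : ∀ m, ∀ Λ ∈ 𝒪' m, IsCPTP Λ) (ε : ℝ) (hρ : IsState ρ) :
    oneShotDistillable 𝒪 ε ρ ≤ oneShotDistillable 𝒪' ε ρ :=
  biSup_mono fun m ⟨hm, hF⟩ => ⟨hm, hF.trans (fidelity_mono (by lia) (h m) (h𝒪' m) hρ)⟩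

theorem asymptoticZeroError_mono
    {𝒪 𝒪' : ∀ n m : ℕ, Set (BMat (Fin n → A) (Fin n → B) →ₗ[ℂ] BMat (Fin m) (Fin m))}
    (h : ∀ n m, 𝒪 n m ⊆ 𝒪' n m) (h𝒪' : ∀ n m, ∀ Λ ∈ 𝒪' n m, IsCPTP Λ) (hρ : IsState ρ) :
    asymptoticZeroError 𝒪 ρ ≤ asymptoticZeroError 𝒪' ρ :=
  limsup_le_limsup <| Eventually.of_forall fun n => mul_le_mul_of_nonneg_left
    (oneShotDistillable_mono (h n) (h𝒪' n) 0 (isState_tensorPow hρ n))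
    (EReal.coe_nonneg.mpr (by positivity))

end Monotonicity

section Asymptotics

theorem neg_logb_two_sub_one_le_logb_floor_inv {x : ℝ} (hx : 0 < x) (hx1 : x ≤ 1) :
    -Real.logb 2 x - 1 ≤ Real.logb 2 (⌊x⁻¹⌋₊ : ℝ) := by
  have hfloor : (1 : ℝ) ≤ ⌊x⁻¹⌋₊ := by
    exact_mod_cast (Nat.one_le_floor_iff _).mpr ((one_le_inv₀ hx).mpr hx1)
  have hhalf : x⁻¹ / 2 ≤ ⌊x⁻¹⌋₊ := by linarith [Nat.lt_floor_add_one x⁻¹]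
  calc -Real.logb 2 x - 1 = Real.logb 2 (x⁻¹ / 2) := by
        rw [Real.logb_div (by positivity) two_ne_zero, Real.logb_inv,
          Real.logb_self_eq_one one_lt_two]
    _ ≤ Real.logb 2 (⌊x⁻¹⌋₊ : ℝ) := Real.logb_le_logb_of_le one_lt_two (by positivity) hhalf

theorem tendsto_one_div_mul_of_le_of_le {u : ℕ → EReal} {L c : ℝ}
    (hlower : ∀ n : ℕ, ((n * L - c : ℝ) : EReal) ≤ u n)
    (hupper : ∀ n : ℕ, u n ≤ ((n * L : ℝ) : EReal)) :
    Tendsto (fun n : ℕ => ((1 / (n : ℝ) : ℝ) : EReal) * u n) atTop (𝓝 (L : EReal)) := by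
  have hnonneg (n : ℕ) : (0 : EReal) ≤ ((1 / (n : ℝ) : ℝ) : EReal) :=
    EReal.coe_nonneg.mpr (by positivity)
  have hlim : Tendsto (fun n : ℕ => ((L - c / n : ℝ) : EReal)) atTop (𝓝 (L : EReal)) := by
    rw [EReal.tendsto_coe]
    simpa using tendsto_const_nhds.sub (tendsto_const_div_atTop_nhds_zero_nat c)
  refine tendsto_of_tendsto_of_tendsto_of_le_of_le' hlim tendsto_const_nhds ?_ ?_ <;>
    filter_upwards [eventually_ne_atTop 0] with n hn
  · calc ((L - c / n : ℝ) : EReal) = ((1 / (n : ℝ) : ℝ) : EReal) * ((n * L - c : ℝ) : EReal) := by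
          rw [← EReal.coe_mul]
          congr 1
          field_simp
      _ ≤ _ := mul_le_mul_of_nonneg_left (hlower n) (hnonneg n)
  · calc ((1 / (n : ℝ) : ℝ) : EReal) * u n
        ≤ ((1 / (n : ℝ) : ℝ) : EReal) * ((n * L : ℝ) : EReal) :=
          mul_le_mul_of_nonneg_left (hupper n) (hnonneg n)
      _ = L := by
          rw [← EReal.coe_mul]
          congr 1
          field_simp

variable {A B : Type*} [Fintype A] [Fintype B] [DecidableEq A] [DecidableEq B] {ρ : BMat A B}

theorem gammaRains_supportProj_pos (hρ : ρ ≠ 0) : 0 < gammaRains (supportProj ρ) :=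
  gammaRains_pos (posSemidef_supportProj ρ) (supportProj_ne_zero hρ)

theorem IsState.ne_zero {α : Type*} [Fintype α] {ρ : Matrix α α ℂ} (hρ : IsState ρ) : ρ ≠ 0 := by
  rintro rfl
  simpa using hρ.2

theorem oneShotDistillable_rainsPreserving_le (hρ : IsState ρ) :
    oneShotDistillable (fun m => rainsPreserving A B (Fin m) (Fin m)) 0 ρ ≤
      ((-Real.logb 2 (gammaRains (supportProj ρ)) : ℝ) : EReal) := by
  refine iSup₂_le fun m ⟨hm, hF⟩ => EReal.coe_le_coe_iff.mpr ?_
  rw [sub_zero, one_le_fidelity_rainsPreserving_iff hm hρ] at hF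
  have hlog := Real.logb_le_logb_of_le one_lt_two (gammaRains_supportProj_pos hρ.ne_zero) hF
  rw [one_div, Real.logb_inv] at hlog
  linarith

theorem le_oneShotDistillable_rainsPreserving (hρ : IsState ρ) :
    ((-Real.logb 2 (gammaRains (supportProj ρ)) - 1 : ℝ) : EReal) ≤
      oneShotDistillable (fun m => rainsPreserving A B (Fin m) (Fin m)) 0 ρ := by
  have hpos := gammaRains_supportProj_pos hρ.ne_zero
  have hle : gammaRains (supportProj ρ) ≤ 1 :=
    gammaRains_le_one (isHermitian_supportProj ρ) (isStarProjection_supportProj ρ).le_one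
  have hfloor : 1 ≤ ⌊(gammaRains (supportProj ρ))⁻¹⌋₊ :=
    (Nat.one_le_floor_iff _).mpr ((one_le_inv₀ hpos).mpr hle)
  refine (EReal.coe_le_coe_iff.mpr (neg_logb_two_sub_one_le_logb_floor_inv hpos hle)).trans ?_
  refine le_iSup₂_of_le ⌊(gammaRains (supportProj ρ))⁻¹⌋₊ ⟨hfloor, ?_⟩ le_rfl
  rw [sub_zero, one_le_fidelity_rainsPreserving_iff hfloor hρ, one_div]
  exact le_inv_of_le_inv₀ (by exact_mod_cast hfloor) (Nat.floor_le (by positivity))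

theorem neg_logb_gammaRains_supportProj_tensorPow (ρ : BMat A B) (n : ℕ) :
    -Real.logb 2 (gammaRains (supportProj (tensorPow ρ n))) =
      n * -Real.logb 2 (gammaRains (supportProj ρ)) := by
  rw [supportProj_tensorPow, gammaRains_tensorPow (posSemidef_supportProj ρ), Real.logb_pow,
    mul_neg]

theorem asymptoticZeroError_rainsPreserving (hρ : IsState ρ) :
    asymptoticZeroError
        (fun n m => rainsPreserving (Fin n → A) (Fin n → B) (Fin m) (Fin m)) ρ =
      ((-Real.logb 2 (gammaRains (supportProj ρ)) : ℝ) : EReal) := by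
  refine (tendsto_one_div_mul_of_le_of_le (c := 1) (fun n => ?_) fun n => ?_).limsup_eq <;>
    rw [← neg_logb_gammaRains_supportProj_tensorPow]
  · exact le_oneShotDistillable_rainsPreserving (isState_tensorPow hρ n)
  · exact oneShotDistillable_rainsPreserving_le (isState_tensorPow hρ n)

theorem asymptoticZeroError_le_of_subset_pptOperations (hρ : IsState ρ)
    {𝒪 : ∀ n m : ℕ, Set (BMat (Fin n → A) (Fin n → B) →ₗ[ℂ] BMat (Fin m) (Fin m))}
    (h : ∀ n m, 𝒪 n m ⊆ pptOperations (Fin n → A) (Fin n → B) (Fin m) (Fin m)) :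
    asymptoticZeroError 𝒪 ρ ≤ ((-Real.logb 2 (gammaRains (supportProj ρ)) : ℝ) : EReal) := by
  rw [← asymptoticZeroError_rainsPreserving hρ]
  exact asymptoticZeroError_mono
    (fun n m => (h n m).trans pptOperations_subset_rainsPreserving) (fun _ _ _ hΛ => hΛ.1) hρ

end Asymptotics

end ZeroErrorRains

end

theorem mainTheorem12 {A B : Type*} [Fintype A] [Fintype B] [DecidableEq A] [DecidableEq B]
    (ρ : ZeroErrorRains.BMat A B) (hρ : ZeroErrorRains.IsState ρ) :
    -- positivity, so that the logarithm below is a genuine one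
    0 < ZeroErrorRains.gammaRains (ZeroErrorRains.supportProj ρ) ∧
    -- the asymptotic zero-error distillable entanglement under Rains-preserving operations
    ZeroErrorRains.asymptoticZeroError
        (fun n m =>
          ZeroErrorRains.rainsPreserving (Fin n → A) (Fin n → B) (Fin m) (Fin m)) ρ =
      ((-Real.logb 2 (ZeroErrorRains.gammaRains (ZeroErrorRains.supportProj ρ)) : ℝ) : EReal) ∧
    -- the dual form of the gauge function, with the minimum attained
    IsLeast
      {r : ℝ | ∃ Q : ZeroErrorRains.BMat A B, Q.IsHermitian ∧
        (Q - ZeroErrorRains.supportProj ρ).PosSemidef ∧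
        r = ZeroErrorRains.opNorm (ZeroErrorRains.partialTranspose A B Q)}
      (ZeroErrorRains.gammaRains (ZeroErrorRains.supportProj ρ)) ∧
    -- multiplicativity under tensor powers
    (∀ n : ℕ,
      ZeroErrorRains.gammaRains (ZeroErrorRains.tensorPow (ZeroErrorRains.supportProj ρ) n) =
        ZeroErrorRains.gammaRains (ZeroErrorRains.supportProj ρ) ^ n) ∧
    -- the resulting bound for every class of PPT operations
    (∀ 𝒪 : ∀ n m : ℕ, Set (ZeroErrorRains.BMat (Fin n → A) (Fin n → B) →ₗ[ℂ]
          ZeroErrorRains.BMat (Fin m) (Fin m)),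
      (∀ n m, 𝒪 n m ⊆
        ZeroErrorRains.pptOperations (Fin n → A) (Fin n → B) (Fin m) (Fin m)) →
      ZeroErrorRains.asymptoticZeroError 𝒪 ρ ≤
        ((-Real.logb 2 (ZeroErrorRains.gammaRains (ZeroErrorRains.supportProj ρ)) : ℝ) :
          EReal)) := by
  have hS := ZeroErrorRains.posSemidef_supportProj ρ
  exact ⟨ZeroErrorRains.gammaRains_supportProj_pos hρ.ne_zero,
    ZeroErrorRains.asymptoticZeroError_rainsPreserving hρ,
    ZeroErrorRains.isLeast_gammaRains hS.isHermitian,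
    ZeroErrorRains.gammaRains_tensorPow hS,
    fun _ h => ZeroErrorRains.asymptoticZeroError_le_of_subset_pptOperations hρ h⟩
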